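/- Let $n\ge 0$ and let $I\subseteq\mathbb R$ be an interval with more than one point and $0\in I$. A linear system $\dot z=Az+Bu,\ y=Cz$ (real input $u$, real output $y$, state space $\mathbb R^N$) is called canonical if its controllability matrix $[B,AB,\dots,A^{N-1}B]$ and its observability matrix (rows $C,CA,\dots,CA^{N-1}$) have rank $N$. A system morphism from $(A_1,B_1,C_1)$ to $(A_2,B_2,C_2)$ is a map $f$ of the state spaces with $f(A_1z+B_1u)=A_2f(z)+B_2u$ and $C_1z=C_2f(z)$ for all $z,u$; the systems are isomorphic, written $\sim_{sys}$, if there is a linear bijective system morphism. If for all $u\in C^1(I,\mathbb R)$ and $z_0\in\mathbb R^N$ the state equation has a unique $C^1$ solution on $I$ with $z(0)=z_0$, the filter of the system is the map $U:C^1(I,\mathbb R)\times\mathbb R^N\to C^1(I,\mathbb R)$ sending $(u,z_0)$ to the output $y=Cz$ of that solution; the input/output system it induces is the set of maps $\{U(\cdot,z_0): z_0\in\mathbb R^N\}$. Let $\mathbb J=\begin{bmatrix}0&\mathbb I_n\\-\mathbb I_n&0\end{bmatrix}$. Let $PH_n$ be the set of systems $\dot z=\mathbb JQz+\mathbf Bu,\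 y=\mathbf B^TQz$ on $\mathbb R^{2n}$ with $(Q,\mathbf B)\in\Theta_{PH_n}$, i.e. $Q$ real symmetric positive definite and $\mathbf B\in\mathbb R^{2n}$; let $PH_n^{can}\subseteq PH_n$ be the set of canonical ones and $\mathcal{PH}_n^{can}$ the set of input/output systems induced by the elements of $PH_n^{can}$. Let $\Theta_{CH_n}=\{(\mathbf d,\mathbf v)\in\mathbb R^n\times\mathbb R^{2n}: d_i>0 \text{ for all } i\}$. For $(\mathbf d,\mathbf v)\in\Theta_{CH_n}$ let $\theta_{CH_n}(\mathbf d,\mathbf v)$ be the system $\dot s=g_1s+(0,\dots,0,1)^Tu,\ y=g_2s$ on $\mathbb R^{2n}$, where $g_1$ is the companion matrix (ones above the diagonal, last row $-a_0,\dots,-a_{2n-1}$) of $\lambda^{2n}+\sum_{i<2n}a_i\lambda^i=\prod_{i=1}^n(\lambda^2+d_i^2)$ and $g_2=[0,c_{2n-1},0,c_{2n-3},\dots,0,c_1]$ with $$c_{2k+1}=\sum_{l=1}^n d_l\Big(\sum_{\substack{j_1<\dots<j_k\\ j_1,\dots,j_k\ne l}}(d_{j_1}\cdots d_{j_k})^2\Big)(v_l^2+v_{n+l}^2).$$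 Let $\Theta^{can}_{CH_n}$ be the set of $(\mathbf d,\mathbf v)\in\Theta_{CH_n}$ for which $\theta_{CH_n}(\mathbf d,\mathbf v)$ is canonical. The group $S_n\rtimes\mathbb T^n$ ($S_n$ permuting the factors of the torus $\mathbb T^n$) acts on $\Theta^{can}_{CH_n}$: a permutation permutes the $d_i$ and, simultaneously, the pairs $(v_i,v_{n+i})$; $\tau\in\mathbb T^n$ fixes $\mathbf d$ and rotates each pair $(v_i,v_{n+i})\in\mathbb R^2$ by $\tau_i$. Then the following hold. 1. For every system in $PH_n$, every $u\in C^1(I,\mathbb R)$ and every initial state $z_0$, the state equation has exactly one $C^1$ solution on $I$ with $z(0)=z_0$. The set of $(Q,\mathbf B)\in\Theta_{PH_n}$ whose system is canonical is open and dense in $\Theta_{PH_n}$. 2. For two systems in $PH_n^{can}$, with filters $U_1,U_2$, the following are equivalent: (a) they are isomorphic; (b) there is a bijective system morphism, not assumed linear, from the first to the second; (c) there is a bijection $f$ of $\mathbb R^{2n}$ with $U_2(u,f(z_0))=U_1(u,z_0)$ for all $u,z_0$; (d) they induce the same input/output system; (e) $U_1(\cdot,0)=U_2(\cdot,0)$.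 In particular there is a bijection $\mathcal{PH}_n^{can}\simeq PH_n^{can}/\!\sim_{sys}$ that sends the input/output system of $s\in PH_n^{can}$ to the class of $s$. 3. $\Theta^{can}_{CH_n}$ is open, and it is dense in $\Theta_{CH_n}$. 4. There is a bijection $PH_n^{can}/\!\sim_{sys}\;\simeq\;\Theta^{can}_{CH_n}/(S_n\rtimes\mathbb T^n)$ that sends the class of $s\in PH_n^{can}$ to the orbit of $(\mathbf d,\mathbf v)$ if and only if $s$ is isomorphic to $\theta_{CH_n}(\mathbf d,\mathbf v)$. For every symplectic matrix $S$ and every $(\mathbf d,\mathbf v)\in\Theta^{can}_{CH_n}$, the port-Hamiltonian system with parameter $\big(S^T\begin{bmatrix}D&0\\0&D\end{bmatrix}S,\;S^{-1}\mathbf v\big)$, $D=\mathrm{diag}(\mathbf d)$, is canonical, and its class is sent to the orbit of $(\mathbf d,\mathbf v)$. 5. The orbit space is globally parametrized by $2n$ real numbers: there is a map $\chi$ into $\mathbb R^{2n}$, smooth on $\Theta^{can}_{CH_n}$, with surjective derivative at every point of $\Theta^{can}_{CH_n}$ and open image $\chi(\Theta^{can}_{CH_n})$, such that two points of $\Theta^{can}_{CH_n}$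 have the same image if and only if they lie in the same $S_n\rtimes\mathbb T^n$-orbit. -/

import Mathlib

open Polynomial

noncomputable section

namespace PortHam

/-! ## Linear single-input/single-output state-space systems -/

/-- The system `z' = A z + B u`, `y = C z`, with state space `ι → ℝ` and real input and output. -/
@[ext]
structure LinSys (ι : Type) where
  A : Matrix ι ι ℝ
  B : ι → ℝ
  C : ι → ℝ

namespace LinSys

variable {ι κ μ : Type} [Fintype ι] [Fintype κ] [Fintype μ]

/-- The state map `F(z, u) = A z + B u`. -/
def stateMap (s : LinSys ι) (z : ι → ℝ) (u : ℝ) : ι → ℝ :=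
  Matrix.mulVec s.A z + u • s.B

/-- The readout `h(z) = C z`. -/
def readout (s : LinSys ι) (z : ι → ℝ) : ℝ :=
  dotProduct s.C z

/-- System morphisms: system equivariance and readout invariance. -/
def IsSystemMorphism (s : LinSys ι) (t : LinSys κ) (f : (ι → ℝ) → (κ → ℝ)) : Prop :=
  (∀ z u, f (s.stateMap z u) = t.stateMap (f z) u) ∧ ∀ z, s.readout z = t.readout (f z)

/-- System isomorphism: a linear bijection of the state spaces that is a system morphism. -/
def SysIso (s : LinSys ι) (t : LinSys κ) : Prop :=
  ∃ f : (ι → ℝ) ≃ₗ[ℝ] (κ → ℝ), IsSystemMorphism s t f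

theorem SysIso.refl (s : LinSys ι) : SysIso s s :=
  ⟨LinearEquiv.refl ℝ _, fun _ _ => rfl, fun _ => rfl⟩

theorem SysIso.symm {s : LinSys ι} {t : LinSys κ} (h : SysIso s t) : SysIso t s := by
  obtain ⟨f, h1, h2⟩ := h
  refine ⟨f.symm, fun z u => ?_, fun z => ?_⟩
  · rw [LinearEquiv.symm_apply_eq, h1, LinearEquiv.apply_symm_apply]
  · rw [h2, LinearEquiv.apply_symm_apply]

theorem SysIso.trans {s : LinSys ι} {t : LinSys κ} {r : LinSys μ}
    (h : SysIso s t) (k : SysIso t r) : SysIso s r := by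
  obtain ⟨f, h1, h2⟩ := h
  obtain ⟨g, k1, k2⟩ := k
  refine ⟨f.trans g, fun z u => ?_, fun z => ?_⟩
  · simp only [LinearEquiv.trans_apply, h1, k1]
  · simp only [LinearEquiv.trans_apply, h2, k2]

variable [DecidableEq ι]

/-- The controllability matrix `[B, A B, A² B, …]`, with as many columns as states. -/
def controllabilityMatrix (s : LinSys ι) : Matrix ι (Fin (Fintype.card ι)) ℝ :=
  Matrix.of fun i k => Matrix.mulVec (s.A ^ (k : ℕ)) s.B i

/-- The observability matrix with rows `C, C A, C A², …`, with as many rows as states. -/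
def observabilityMatrix (s : LinSys ι) : Matrix (Fin (Fintype.card ι)) ι ℝ :=
  Matrix.of fun k j => Matrix.vecMul s.C (s.A ^ (k : ℕ)) j

def IsControllable (s : LinSys ι) : Prop :=
  s.controllabilityMatrix.rank = Fintype.card ι

def IsObservable (s : LinSys ι) : Prop :=
  s.observabilityMatrix.rank = Fintype.card ι

/-- Canonical systems: controllable and observable. -/
def IsCanonical (s : LinSys ι) : Prop :=
  s.IsControllable ∧ s.IsObservable

end LinSys

/-! ## Filters -/

/-- The space `C¹(I, E)` of continuously differentiable functions on the set `I`
(one-sided at end points of an interval that belong to it). -/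
def C1 (I : Set ℝ) (E : Type) [NormedAddCommGroup E] [NormedSpace ℝ E] :
    Submodule ℝ (I → E) where
  carrier := {f | ∃ g : ℝ → E, ContDiffOn ℝ 1 g I ∧ ∀ t : I, f t = g t}
  add_mem' := by
    rintro f f' ⟨g, hg, h⟩ ⟨g', hg', h'⟩
    exact ⟨g + g', hg.add hg', fun t => by simp [h, h']⟩
  zero_mem' := ⟨fun _ => 0, contDiffOn_const, fun _ => rfl⟩
  smul_mem' := by
    rintro c f ⟨g, hg, h⟩
    exact ⟨fun t => c • g t, hg.const_smul c, fun t => by simp [h]⟩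

namespace LinSys

variable {ι : Type} [Fintype ι]

/-- `z ∈ C¹(I, ℝ^ι)` solves `z' = F(z, u)` on `I` with `z(0) = z₀`. -/
def IsSolution (I : Set ℝ) (s : LinSys ι) (u : C1 I ℝ) (z₀ : ι → ℝ) (z : C1 I (ι → ℝ)) : Prop :=
  (∀ t : I, (t : ℝ) = 0 → z.1 t = z₀) ∧
  ∃ g : ℝ → ι → ℝ, (∀ t : I, z.1 t = g t) ∧
    ∀ t : I, HasDerivWithinAt g (s.stateMap (z.1 t) (u.1 t)) I t

/-- The output `y = h(z)` along a state trajectory. -/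
def output {I : Set ℝ} (s : LinSys ι) (z : C1 I (ι → ℝ)) : C1 I ℝ :=
  ⟨fun t => s.readout (z.1 t), by
    obtain ⟨g, hg, h⟩ := z.2
    refine ⟨fun t => s.readout (g t), ?_, fun t => congrArg s.readout (h t)⟩
    have hg' := contDiffOn_pi.1 hg
    unfold readout dotProduct
    exact ContDiffOn.sum fun i _ => contDiffOn_const.mul (hg' i)⟩

/-- The filter `U : C¹(I) × ℝ^ι → C¹(I)`: the output of the solution with given input and given
initial state at time `0`. -/
def filter (I : Set ℝ) (s : LinSys ι) (u : C1 I ℝ) (z₀ : ι → ℝ) : C1 I ℝ :=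
  s.output (Classical.epsilon fun z : C1 I (ι → ℝ) => s.IsSolution I u z₀ z)

/-- The input/output system induced by a state-space system: the family of input/output maps
`u ↦ U(u, z₀)` given by its filter, the initial states being forgotten. -/
def ioSystem (I : Set ℝ) (s : LinSys ι) : Set (C1 I ℝ → C1 I ℝ) :=
  Set.range fun z₀ : ι → ℝ => fun u : C1 I ℝ => s.filter I u z₀

end LinSys

/-! ## Normal form port-Hamiltonian systems -/

/-- The canonical symplectic matrix `[[0, 1], [-1, 0]]`. -/
def JJ (n : ℕ) : Matrix (Fin n ⊕ Fin n) (Fin n ⊕ Fin n) ℝ :=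
  Matrix.fromBlocks 0 1 (-1) 0

/-- The parameters `(Q, B)` with `Q` symmetric positive definite. -/
def ThetaPH (n : ℕ) :
    Set (Matrix (Fin n ⊕ Fin n) (Fin n ⊕ Fin n) ℝ × (Fin n ⊕ Fin n → ℝ)) :=
  {p | p.1.PosDef}

/-- The system `z' = J Q z + B u`, `y = Bᵀ Q z`. -/
def phSystem {n : ℕ} (p : Matrix (Fin n ⊕ Fin n) (Fin n ⊕ Fin n) ℝ × (Fin n ⊕ Fin n → ℝ)) :
    LinSys (Fin n ⊕ Fin n) where
  A := JJ n * p.1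
  B := p.2
  C := Matrix.vecMul p.2 p.1

/-- The set of normal form port-Hamiltonian systems with `2n`-dimensional state space. -/
def PH (n : ℕ) : Set (LinSys (Fin n ⊕ Fin n)) :=
  phSystem '' ThetaPH n

/-- The canonical ones among them. -/
def PHcan (n : ℕ) : Set (LinSys (Fin n ⊕ Fin n)) :=
  {s | s ∈ PH n ∧ s.IsCanonical}

/-- System isomorphism as an equivalence relation on the canonical port-Hamiltonian systems. -/
def sysSetoid (n : ℕ) : Setoid (PHcan n) where
  r s t := LinSys.SysIso s.1 t.1
  iseqv := ⟨fun _ => LinSys.SysIso.refl _, fun h => h.symm, fun h k => h.trans k⟩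

/-- The input/output systems induced by the canonical port-Hamiltonian systems. -/
def FilterPHcan (n : ℕ) (I : Set ℝ) : Set (Set (C1 I ℝ → C1 I ℝ)) :=
  LinSys.ioSystem I '' PHcan n

/-! ## Controllable Hamiltonian representations -/

/-- The ambient space of the parameters `(d, v)`, with `d ∈ ℝⁿ` and `v ∈ ℝ²ⁿ`. -/
abbrev Par (n : ℕ) : Type := (Fin n → ℝ) × (Fin n ⊕ Fin n → ℝ)

def ThetaCH (n : ℕ) : Set (Par n) := {x | ∀ i, 0 < x.1 i}

/-- The polynomial `∏ᵢ (λ² + dᵢ²)`, with coefficients `a₀, …, a₂ₙ₋₁, 1`. -/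
def dPoly {n : ℕ} (d : Fin n → ℝ) : ℝ[X] := ∏ i, (X ^ 2 + C (d i ^ 2))

/-- The companion matrix with last row `-a₀, …, -a₂ₙ₋₁`. -/
def gCtr1 {n : ℕ} (d : Fin n → ℝ) : Matrix (Fin (2 * n)) (Fin (2 * n)) ℝ :=
  Matrix.of fun i j =>
    if (i : ℕ) + 1 = 2 * n then -(dPoly d).coeff j
    else if (j : ℕ) = i + 1 then 1 else 0

/-- `f_l = d_l ∑ (d_{j₁} ⋯ d_{j_k})²`, summed over the `k`-element subsets of indices `≠ l`. -/
def fCoef {n : ℕ} (d : Fin n → ℝ) (k : ℕ) (l : Fin n) : ℝ :=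
  d l * ∑ s ∈ Finset.powersetCard k (Finset.univ.erase l), (∏ j ∈ s, d j) ^ 2

/-- `c_{2k+1} = vᵀ diag(F_k, F_k) v`. -/
def cCoef {n : ℕ} (x : Par n) (k : ℕ) : ℝ :=
  dotProduct x.2 (Matrix.mulVec (Matrix.fromBlocks (Matrix.diagonal (fCoef x.1 k)) 0 0
    (Matrix.diagonal (fCoef x.1 k))) x.2)

/-- The row `[0, c_{2n-1}, 0, c_{2n-3}, …, 0, c_1]`: position `i` (counted from `0`) holds
`c_{2n-i}` if `i` is odd, and `0` if `i` is even. -/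
def gCtr2 {n : ℕ} (x : Par n) : Fin (2 * n) → ℝ :=
  fun i => if Even (i : ℕ) then 0 else cCoef x ((2 * n - 1 - i) / 2)

/-- The controllable Hamiltonian representation with parameter `(d, v)`. -/
def chSystem {n : ℕ} (x : Par n) : LinSys (Fin (2 * n)) where
  A := gCtr1 x.1
  B := fun i => if (i : ℕ) + 1 = 2 * n then 1 else 0
  C := gCtr2 x

/-- The parameters whose controllable Hamiltonian representation is canonical. -/
def ThetaCHcan (n : ℕ) : Set (Par n) :=
  {x | x ∈ ThetaCH n ∧ (chSystem x).IsCanonical}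

/-- The port-Hamiltonian system with parameter `(Sᵀ diag(D, D) S, S⁻¹ v)`. -/
def phiS {n : ℕ} (S : Matrix (Fin n ⊕ Fin n) (Fin n ⊕ Fin n) ℝ) (x : Par n) :
    LinSys (Fin n ⊕ Fin n) :=
  phSystem (S.transpose * Matrix.fromBlocks (Matrix.diagonal x.1) 0 0 (Matrix.diagonal x.1) * S,
    Matrix.mulVec S⁻¹ x.2)

/-! ## The action of the semidirect product of the symmetric group and the torus -/

/-- The semidirect product of `Sₙ` and the torus `𝕋ⁿ`, where `Sₙ` permutes the coordinates of
the torus. -/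
abbrev PermTorus (n : ℕ) : Type :=
  (Fin n → Circle) ⋊[mulAutArrow] Equiv.Perm (Fin n)

/-- A permutation permutes the `d_i` and the planes of coordinates `(v_i, v_{n+i})`; an element
`τ` of the torus then rotates the `i`-th plane by `τ_i`. -/
def act {n : ℕ} (g : PermTorus n) (x : Par n) : Par n :=
  (fun i => x.1 (g.right⁻¹ i),
   Sum.elim
    (fun i => (g.left i : ℂ).re * x.2 (Sum.inl (g.right⁻¹ i))
      - (g.left i : ℂ).im * x.2 (Sum.inr (g.right⁻¹ i)))
    (fun i => (g.left i : ℂ).im * x.2 (Sum.inl (g.right⁻¹ i))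
      + (g.left i : ℂ).re * x.2 (Sum.inr (g.right⁻¹ i))))

theorem act_one {n : ℕ} (x : Par n) : act 1 x = x := by
  ext i
  · simp [act]
  · rcases i with i | i <;> simp [act]

theorem act_mul {n : ℕ} (g h : PermTorus n) (x : Par n) : act (g * h) x = act g (act h x) := by
  ext i
  · simp [act]
  · have h1 : ∀ i, mulAutArrow g.right h.left i = h.left (g.right⁻¹ i) := fun _ => rfl
    rcases i with i | i <;>
      simp [act, SemidirectProduct.mul_left, -mulAutArrow_apply_apply, h1] <;> ring

theorem dPoly_act {n : ℕ} (g : PermTorus n) (x : Par n) : dPoly (act g x).1 = dPoly x.1 :=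
  Equiv.prod_comp g.right⁻¹ fun i => (X ^ 2 + C (x.1 i ^ 2) : ℝ[X])

theorem fCoef_act {n : ℕ} (g : PermTorus n) (x : Par n) (k : ℕ) (l : Fin n) :
    fCoef (act g x).1 k l = fCoef x.1 k (g.right⁻¹ l) := by
  unfold fCoef
  congr 1
  have h : (Finset.univ.erase (g.right⁻¹ l) : Finset (Fin n))
      = (Finset.univ.erase l).map (g.right⁻¹).toEmbedding := by
    rw [Finset.map_erase]; simp
  rw [h, Finset.powersetCard_map, Finset.sum_map]
  refine Finset.sum_congr rfl fun s _ => ?_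
  change _ = (∏ j ∈ s.map (g.right⁻¹).toEmbedding, x.1 j) ^ 2
  rw [Finset.prod_map]
  rfl

theorem cCoef_eq {n : ℕ} (x : Par n) (k : ℕ) :
    cCoef x k = ∑ i, fCoef x.1 k i * (x.2 (Sum.inl i) ^ 2 + x.2 (Sum.inr i) ^ 2) := by
  unfold cCoef
  rw [Matrix.fromBlocks_mulVec]
  simp only [dotProduct, Fintype.sum_sum_type, ← Finset.sum_add_distrib]
  refine Finset.sum_congr rfl fun i _ => ?_
  simp [Matrix.mulVec_diagonal]
  ring

theorem cCoef_act {n : ℕ} (g : PermTorus n) (x : Par n) (k : ℕ) :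
    cCoef (act g x) k = cCoef x k := by
  rw [cCoef_eq, cCoef_eq, ← Equiv.sum_comp g.right⁻¹
    fun i => fCoef x.1 k i * (x.2 (Sum.inl i) ^ 2 + x.2 (Sum.inr i) ^ 2)]
  refine Finset.sum_congr rfl fun i _ => ?_
  rw [fCoef_act]
  congr 1
  have h : (g.left i : ℂ).re ^ 2 + (g.left i : ℂ).im ^ 2 = 1 := by
    have := Circle.normSq_coe (g.left i)
    rw [Complex.normSq_apply] at this
    linarith
  simp only [act, Sum.elim_inl, Sum.elim_inr]
  linear_combination (x.2 (Sum.inl (g.right⁻¹ i)) ^ 2 + x.2 (Sum.inr (g.right⁻¹ i)) ^ 2) * h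

theorem chSystem_act {n : ℕ} (g : PermTorus n) (x : Par n) : chSystem (act g x) = chSystem x := by
  have h1 : gCtr1 (act g x).1 = gCtr1 x.1 := by unfold gCtr1; rw [dPoly_act]
  have h2 : gCtr2 (act g x) = gCtr2 x := by
    funext i; unfold gCtr2; rw [cCoef_act]
  unfold chSystem
  rw [h1, h2]

theorem act_mem {n : ℕ} (g : PermTorus n) {x : Par n} (hx : x ∈ ThetaCHcan n) :
    act g x ∈ ThetaCHcan n :=
  ⟨fun i => hx.1 (g.right⁻¹ i), by rw [chSystem_act]; exact hx.2⟩

instance instActThetaCHcan (n : ℕ) : MulAction (PermTorus n) (ThetaCHcan n) where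
  smul g x := ⟨act g x.1, act_mem g x.2⟩
  one_smul x := Subtype.ext (act_one x.1)
  mul_smul g h x := Subtype.ext (act_mul g h x.1)

end PortHam

end

/-!
A single-input single-output system that is controllable and observable is determined up to linear
isomorphism by its Markov parameters `C Aᵏ B` (`LinSys.sysIso_of_markov_eq`, proved by identifying
both state spaces with the same quotient of `ℝ[X]`). The filter determines the Markov parameters,
because they are the derivatives at time `0` of the response to the constant input `1` from rest;
together with the observability of the target this makes all the notions of equivalence of filters
coincide (`LinSys.sysIso_tfae`).

The Markov parameters of a port-Hamiltonian system are those of a finite family of harmonic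
oscillators, `∑ cⱼ Re (i dⱼ)ᵏ` with `dⱼ > 0` and `cⱼ ≥ 0` (`exists_osc_of_posDef`): if `Q = MᵀM`, the
system matrix is similar to the skew-symmetric `M J Mᵀ`. After equal frequencies have been grouped and
unexcited ones dropped, the decoupled oscillators form a canonical system, so by the realization
theorem a canonical port-Hamiltonian system of dimension `2n` is isomorphic to exactly `n` oscillators
with distinct frequencies, all of them excited; no symplectic normal form of `Q` is needed. The
controllable Hamiltonian representation of `(d, v)` has the same Markov parameters as the oscillators
with these data (`chSystem_markov`, by synthetic division of `∏ (λ² + dᵢ²)`), and by the same count it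
is canonical exactly for distinct `dᵢ > 0` and nonzero `(vᵢ, vₙ₊ᵢ)` (`mem_ThetaCHcan_iff`).

Up to sign, the even Markov parameters are the moments of the measure on the line with mass
`dᵢ (vᵢ² + vₙ₊ᵢ²)` at `dᵢ²`. Polynomials of degree below `2n` separate two such measures with `n` atoms
each, so the first `2n` moments determine the frequencies and amplitudes up to order, that is, the
orbit of `(d, v)` (`momentChart_eq_iff`). They also serve as the chart: a functional that
annihilates the derivative of the moments is a polynomial of degree below `2n` with `n` double roots
(`Generic.surjective_fderiv_momentChart`).
-/

open Polynomial

noncomputable section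

namespace PortHam

/-! ### Controllability, observability and the realization theorem -/

/-- Full row rank means trivial left kernel. -/
theorem rank_eq_card_iff {ι κ : Type*} [Fintype ι] [Fintype κ] (M : Matrix ι κ ℝ) :
    M.rank = Fintype.card ι ↔ ∀ y : ι → ℝ, Matrix.vecMul y M = 0 → y = 0 := by
  classical
  have h1 : (∀ y : ι → ℝ, Matrix.vecMul y M = 0 → y = 0) ↔
      LinearIndependent ℝ M.row := by
    rw [← Matrix.vecMul_injective_iff]
    exact (injective_iff_map_eq_zero (Matrix.vecMulLinear M)).symm
  rw [h1, linearIndependent_iff_card_eq_finrank_span, Matrix.rank_eq_finrank_span_row, eq_comm]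
  rfl

theorem rank_eq_card_iff_det_gram_ne_zero {ι κ : Type*} [Fintype ι] [Fintype κ] [DecidableEq ι]
    (M : Matrix ι κ ℝ) :
    M.rank = Fintype.card ι ↔ (M * M.transpose).det ≠ 0 := by
  rw [← Matrix.rank_self_mul_transpose M, rank_eq_card_iff, Ne, ← Matrix.exists_vecMul_eq_zero_iff]
  push Not
  exact forall_congr' fun y => ⟨fun h hy hz => hy (h hz), fun h hz => by_contra fun hy => h hy hz⟩

/-- By the Cayley–Hamilton theorem, a linear functional of the powers of an `N × N` matrix that
vanishes on the powers below `N` vanishes on all of them. -/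
theorem map_pow_eq_zero_of_lt_card {ι : Type*} [Fintype ι] [DecidableEq ι]
    (A : Matrix ι ι ℝ) (f : Matrix ι ι ℝ →ₗ[ℝ] ℝ)
    (h : ∀ k < Fintype.card ι, f (A ^ k) = 0) (k : ℕ) : f (A ^ k) = 0 := by
  rw [Matrix.pow_eq_aeval_mod_charpoly, aeval_def, eval₂_eq_sum, Polynomial.sum, map_sum]
  refine Finset.sum_eq_zero fun j hj => ?_
  have hlt : (X ^ k %ₘ A.charpoly).degree < (Fintype.card ι : WithBot ℕ) := by
    rw [← Matrix.charpoly_degree_eq_dim A]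
    exact degree_modByMonic_lt _ A.charpoly_monic
  have hj' : j < Fintype.card ι := by
    by_contra hc
    refine mem_support_iff.1 hj (coeff_eq_zero_of_degree_lt (hlt.trans_le ?_))
    exact_mod_cast not_lt.1 hc
  rw [← Algebra.smul_def, map_smul, h j hj', smul_zero]

theorem dual_eq_dotProduct {ι : Type*} [Fintype ι] [DecidableEq ι] (f : (ι → ℝ) →ₗ[ℝ] ℝ)
    (z : ι → ℝ) : f z = (fun i => f (Pi.single i 1)) ⬝ᵥ z := by
  conv_lhs => rw [pi_eq_sum_univ' z]
  simp [dotProduct, mul_comm]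

namespace LinSys

variable {ι κ μ : Type} [Fintype ι] [Fintype κ] [Fintype μ]
  [DecidableEq ι] [DecidableEq κ] [DecidableEq μ]

/-- The Markov parameters `C Aᵏ B`. -/
def markov (s : LinSys ι) (k : ℕ) : ℝ :=
  s.C ⬝ᵥ Matrix.mulVec (s.A ^ k) s.B

/-- Controllability in terms of all powers of `A`: those beyond the columns of the controllability
matrix add nothing, by Cayley–Hamilton. -/
theorem isControllable_iff (s : LinSys ι) :
    s.IsControllable ↔
      ∀ y : ι → ℝ, (∀ k, y ⬝ᵥ Matrix.mulVec (s.A ^ k) s.B = 0) → y = 0 := by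
  unfold IsControllable
  rw [rank_eq_card_iff]
  refine forall_congr' fun y => imp_congr ?_ Iff.rfl
  constructor
  · intro h
    let f : Matrix ι ι ℝ →ₗ[ℝ] ℝ :=
      { toFun := fun M => y ⬝ᵥ Matrix.mulVec M s.B
        map_add' := fun M N => by rw [Matrix.add_mulVec, dotProduct_add]
        map_smul' := fun c M => by rw [Matrix.smul_mulVec, dotProduct_smul]; rfl }
    refine map_pow_eq_zero_of_lt_card s.A f fun k hk => ?_
    exact congrFun h ⟨k, hk⟩
  · intro h
    funext k
    exact h k

/-- The dual criterion for observability. -/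
theorem isObservable_iff (s : LinSys ι) :
    s.IsObservable ↔
      ∀ z : ι → ℝ, (∀ k, s.C ⬝ᵥ Matrix.mulVec (s.A ^ k) z = 0) → z = 0 := by
  unfold IsObservable
  rw [← Matrix.rank_transpose, rank_eq_card_iff]
  refine forall_congr' fun z => imp_congr ?_ Iff.rfl
  rw [Matrix.vecMul_transpose]
  constructor
  · intro h
    let f : Matrix ι ι ℝ →ₗ[ℝ] ℝ :=
      { toFun := fun M => s.C ⬝ᵥ Matrix.mulVec M z
        map_add' := fun M N => by rw [Matrix.add_mulVec, dotProduct_add]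
        map_smul' := fun c M => by rw [Matrix.smul_mulVec, dotProduct_smul]; rfl }
    refine map_pow_eq_zero_of_lt_card s.A f fun k hk => ?_
    have := congrFun h ⟨k, hk⟩
    change s.C ⬝ᵥ Matrix.mulVec (s.A ^ k) z = 0
    rw [Matrix.dotProduct_mulVec]
    exact this
  · intro h
    funext k
    have := h k
    rw [Matrix.dotProduct_mulVec] at this
    exact this

/-- The map `p ↦ p(A) B` from polynomials to states. -/
def reach (s : LinSys ι) : ℝ[X] →ₗ[ℝ] (ι → ℝ) where
  toFun p := Matrix.mulVec (aeval s.A p) s.B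
  map_add' p q := by rw [map_add, Matrix.add_mulVec]
  map_smul' c p := by rw [map_smul, Matrix.smul_mulVec]; rfl

theorem reach_X_mul (s : LinSys ι) (p : ℝ[X]) :
    s.reach (X * p) = Matrix.mulVec s.A (s.reach p) := by
  simp [reach, Matrix.mulVec_mulVec]

theorem reach_one (s : LinSys ι) : s.reach 1 = s.B := by simp [reach]

theorem reach_X_pow (s : LinSys ι) (k : ℕ) : s.reach (X ^ k) = Matrix.mulVec (s.A ^ k) s.B := by
  simp [reach]

theorem reach_surjective {s : LinSys ι} (h : s.IsControllable) :
    Function.Surjective s.reach := by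
  rw [← LinearMap.range_eq_top]
  by_contra hne
  obtain ⟨f, hf, hker⟩ := Submodule.exists_le_ker_of_lt_top _ (lt_top_iff_ne_top.2 hne)
  have hf' := dual_eq_dotProduct f
  refine hf (LinearMap.ext fun z => ?_)
  rw [hf', (isControllable_iff s).1 h (fun i => f (Pi.single i 1)) fun k => ?_]
  · simp
  · rw [← hf', ← reach_X_pow]
    exact hker ⟨_, rfl⟩

/-- What is observed from the state `p(A) B` depends on the Markov parameters only. -/
theorem readout_pow_reach (s : LinSys ι) (k : ℕ) (p : ℝ[X]) :
    s.C ⬝ᵥ Matrix.mulVec (s.A ^ k) (s.reach p) = p.sum fun j a => a * s.markov (k + j) := by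
  rw [reach, LinearMap.coe_mk, AddHom.coe_mk, Matrix.mulVec_mulVec, aeval_def, eval₂_eq_sum]
  unfold Polynomial.sum
  rw [Finset.mul_sum, Matrix.sum_mulVec, dotProduct_sum]
  refine Finset.sum_congr rfl fun j _ => ?_
  beta_reduce
  rw [← Algebra.smul_def, mul_smul_comm, ← pow_add, Matrix.smul_mulVec, dotProduct_smul]
  rfl

/-- If `s` is controllable, `t` is canonical and the Markov parameters agree, then
`p(A) B ↦ p(A') B'` is a well-defined surjective linear system morphism from `s` to `t`. -/
theorem exists_surjective_of_markov_eq {s : LinSys ι} {t : LinSys κ} (hs : s.IsControllable)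
    (ht : t.IsCanonical) (h : ∀ k, s.markov k = t.markov k) :
    ∃ f : (ι → ℝ) →ₗ[ℝ] (κ → ℝ), Function.Surjective f ∧ IsSystemMorphism s t f := by
  have hker : s.reach.ker ≤ t.reach.ker := by
    intro p hp
    refine (isObservable_iff t).1 ht.2 _ fun k => ?_
    rw [readout_pow_reach]
    simp_rw [← h]
    rw [← readout_pow_reach, LinearMap.mem_ker.1 hp]
    simp
  let e := s.reach.quotKerEquivOfSurjective (reach_surjective hs)
  let f : (ι → ℝ) →ₗ[ℝ] (κ → ℝ) := (s.reach.ker.liftQ t.reach hker) ∘ₗ e.symm.toLinearMap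
  have hf : ∀ p, f (s.reach p) = t.reach p := fun p => by
    have : e.symm (s.reach p) = Submodule.Quotient.mk p := by
      rw [LinearEquiv.symm_apply_eq]; rfl
    change s.reach.ker.liftQ t.reach hker (e.symm (s.reach p)) = _
    rw [this]; rfl
  refine ⟨f, fun y => ?_, fun z u => ?_, fun z => ?_⟩
  · obtain ⟨p, rfl⟩ := reach_surjective ht.1 y
    exact ⟨_, hf p⟩
  · obtain ⟨p, rfl⟩ := reach_surjective hs z
    unfold stateMap
    rw [map_add, map_smul, hf, ← reach_X_mul, hf, reach_X_mul, ← reach_one s, hf, reach_one]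
  · obtain ⟨p, rfl⟩ := reach_surjective hs z
    unfold readout
    have h1 := readout_pow_reach s 0 p
    have h2 := readout_pow_reach t 0 p
    simp_rw [h] at h1
    rw [← h2] at h1
    simpa [hf] using h1

/-- Kalman's realization theorem: canonical systems with equal Markov parameters are
isomorphic. -/
theorem sysIso_of_markov_eq {s : LinSys ι} {t : LinSys κ} (hs : s.IsCanonical)
    (ht : t.IsCanonical) (h : ∀ k, s.markov k = t.markov k) : SysIso s t := by
  obtain ⟨f, hf, hm⟩ := exists_surjective_of_markov_eq hs.1 ht h
  obtain ⟨g, hg, -⟩ := exists_surjective_of_markov_eq ht.1 hs fun k => (h k).symm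
  have hfin : Module.finrank ℝ (ι → ℝ) = Module.finrank ℝ (κ → ℝ) :=
    le_antisymm (LinearMap.finrank_le_finrank_of_surjective hg)
      (LinearMap.finrank_le_finrank_of_surjective hf)
  refine ⟨LinearEquiv.ofBijective f
    ⟨(LinearMap.injective_iff_surjective_of_finrank_eq_finrank hfin).2 hf, hf⟩, hm⟩

omit [DecidableEq ι] [DecidableEq κ] in
theorem SysIso.card_eq {s : LinSys ι} {t : LinSys κ} (h : SysIso s t) :
    Fintype.card ι = Fintype.card κ := by
  obtain ⟨f, -⟩ := h
  simpa using f.finrank_eq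

/-- A system morphism, linear or not, intertwines the powers of the system matrices. -/
theorem IsSystemMorphism.map_pow {s : LinSys ι} {t : LinSys κ} {f : (ι → ℝ) → (κ → ℝ)}
    (h : IsSystemMorphism s t f) (k : ℕ) (z : ι → ℝ) :
    f (Matrix.mulVec (s.A ^ k) z) = Matrix.mulVec (t.A ^ k) (f z) := by
  induction k generalizing z with
  | zero => simp
  | succ k ih =>
    rw [pow_succ, ← Matrix.mulVec_mulVec, ih, pow_succ, ← Matrix.mulVec_mulVec]
    have := h.1 z 0
    simp only [stateMap, zero_smul, add_zero] at this
    rw [this]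

theorem IsSystemMorphism.readout_pow {s : LinSys ι} {t : LinSys κ} {f : (ι → ℝ) → (κ → ℝ)}
    (h : IsSystemMorphism s t f) (k : ℕ) (z : ι → ℝ) :
    t.C ⬝ᵥ Matrix.mulVec (t.A ^ k) (f z) = s.C ⬝ᵥ Matrix.mulVec (s.A ^ k) z := by
  rw [← h.map_pow]
  exact (h.2 _).symm

theorem IsSystemMorphism.markov_eq {s : LinSys ι} {t : LinSys κ} {f : (ι → ℝ) → (κ → ℝ)}
    (h : IsSystemMorphism s t f) (h0 : f 0 = 0) (k : ℕ) : s.markov k = t.markov k := by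
  have hB : f s.B = t.B := by
    have := h.1 0 1
    simpa [stateMap, h0] using this
  unfold markov
  rw [← h.readout_pow, hB]

/-- A system morphism into an observable system fixes the origin, whether linear or not. -/
theorem IsSystemMorphism.map_zero {s : LinSys ι} {t : LinSys κ} {f : (ι → ℝ) → (κ → ℝ)}
    (h : IsSystemMorphism s t f) (ht : t.IsObservable) : f 0 = 0 := by
  refine (isObservable_iff t).1 ht _ fun k => ?_
  rw [h.readout_pow]
  simp

theorem SysIso.markov_eq {s : LinSys ι} {t : LinSys κ} (h : SysIso s t) (k : ℕ) :
    s.markov k = t.markov k := by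
  obtain ⟨f, hf⟩ := h
  exact hf.markov_eq (_root_.map_zero f) k

theorem SysIso.isCanonical {s : LinSys ι} {t : LinSys κ} (h : SysIso s t)
    (hs : s.IsCanonical) : t.IsCanonical := by
  obtain ⟨f, hf⟩ := h.symm
  have hB : f t.B = s.B := by
    have := hf.1 0 1
    simpa [stateMap] using this
  refine ⟨(isControllable_iff t).2 fun y hy => ?_, (isObservable_iff t).2 fun z hz => ?_⟩
  · have h1 : ∀ z, (fun i => y ⬝ᵥ f.symm (Pi.single i 1)) ⬝ᵥ z = y ⬝ᵥ f.symm z := fun z =>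
      (dual_eq_dotProduct
        { toFun := fun z => y ⬝ᵥ f.symm z
          map_add' := fun a b => by rw [map_add, dotProduct_add]
          map_smul' := fun c a => by rw [map_smul, dotProduct_smul]; rfl } z).symm
    have h2 := (isControllable_iff s).1 hs.1 (fun i => y ⬝ᵥ f.symm (Pi.single i 1)) fun k => by
      rw [h1, ← hB, ← hf.map_pow, LinearEquiv.symm_apply_apply]
      exact hy k
    funext j
    have h3 := h1 (f (Pi.single j 1))
    rw [h2] at h3
    simpa using h3.symm
  · have : f z = 0 := (isObservable_iff s).1 hs.2 _ fun k => by rw [hf.readout_pow]; exact hz k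
    simpa using this

/-- A controllable system with the Markov parameters of a canonical system of the same dimension
is canonical. -/
theorem isCanonical_of_markov_eq {s : LinSys ι} {t : LinSys κ} (hs : s.IsControllable)
    (ht : t.IsCanonical) (h : ∀ k, s.markov k = t.markov k)
    (hc : Fintype.card ι = Fintype.card κ) : s.IsCanonical := by
  obtain ⟨f, hf, hm⟩ := exists_surjective_of_markov_eq hs ht h
  have hi := (LinearMap.injective_iff_surjective_of_finrank_eq_finrank
    (f := f) (by simpa using hc)).2 hf
  exact SysIso.isCanonical (SysIso.symm ⟨LinearEquiv.ofBijective f ⟨hi, hf⟩, hm⟩) ht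

end LinSys

/-! ### Linear differential equations on an interval -/

/-- Any two points of an interval lie in a compact subinterval that is a relative neighbourhood of
the second. -/
theorem exists_Icc_mem_nhdsWithin {I : Set ℝ} {x t : ℝ} (hx : x ∈ I) (ht : t ∈ I) :
    ∃ a ∈ I, ∃ b ∈ I, x ∈ Set.Icc a b ∧ t ∈ Set.Icc a b ∧ Set.Icc a b ∈ nhdsWithin t I := by
  have hb : ∃ b ∈ I, x ≤ b ∧ t ≤ b ∧ Set.Iic b ∈ nhdsWithin t I := by
    by_cases h : ∃ b ∈ I, t < b
    · obtain ⟨b, hb, htb⟩ := h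
      refine ⟨max x b, ?_, le_max_left _ _, htb.le.trans (le_max_right _ _),
        mem_nhdsWithin_of_mem_nhds (Iic_mem_nhds (htb.trans_le (le_max_right _ _)))⟩
      rcases max_choice x b with h | h <;> rw [h] <;> assumption
    · push Not at h
      exact ⟨t, ht, h x hx, le_rfl, Filter.mem_of_superset self_mem_nhdsWithin h⟩
  have ha : ∃ a ∈ I, a ≤ x ∧ a ≤ t ∧ Set.Ici a ∈ nhdsWithin t I := by
    by_cases h : ∃ a ∈ I, a < t
    · obtain ⟨a, ha, hat⟩ := h
      refine ⟨min x a, ?_, min_le_left _ _, (min_le_right _ _).trans hat.le,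
        mem_nhdsWithin_of_mem_nhds (Ici_mem_nhds ((min_le_right _ _).trans_lt hat))⟩
      rcases min_choice x a with h | h <;> rw [h] <;> assumption
    · push Not at h
      exact ⟨t, ht, h x hx, le_rfl, Filter.mem_of_superset self_mem_nhdsWithin h⟩
  obtain ⟨b, hbI, hxb, htb, hb⟩ := hb
  obtain ⟨a, haI, hax, hat, ha⟩ := ha
  exact ⟨a, haI, b, hbI, ⟨hax, hxb⟩, ⟨hat, htb⟩, Filter.inter_mem ha hb⟩

/-- The integral of a function continuous on an interval, of any kind, is a primitive there. -/
theorem hasDerivWithinAt_integral {E : Type*} [NormedAddCommGroup E] [NormedSpace ℝ E]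
    [CompleteSpace E] {I : Set ℝ} (hI : I.OrdConnected) {f : ℝ → E} (hf : ContinuousOn f I)
    {x t : ℝ} (hx : x ∈ I) (ht : t ∈ I) :
    HasDerivWithinAt (fun r => ∫ y in x..r, f y) (f t) I t := by
  obtain ⟨a, haI, b, hbI, -, htab, hnhds⟩ := exists_Icc_mem_nhdsWithin hx ht
  have hsub : Set.Icc a b ⊆ I := hI.out haI hbI
  have : Fact (t ∈ Set.Icc a b) := ⟨htab⟩
  have h : HasDerivWithinAt (fun r => ∫ y in x..r, f y) (f t) (Set.Icc a b) t :=
    intervalIntegral.integral_hasDerivWithinAt_right (t := Set.Icc a b)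
      ((hf.mono (hI.uIcc_subset hx ht)).intervalIntegrable)
      ((hf.mono hsub).stronglyMeasurableAtFilter_nhdsWithin measurableSet_Icc t)
      ((hf.mono hsub) t htab)
  exact h.mono_of_mem_nhdsWithin hnhds

theorem uniqueDiffOn_of_ordConnected {I : Set ℝ} (hI : I.OrdConnected) (hI' : I.Nontrivial) :
    UniqueDiffOn ℝ I := by
  obtain ⟨x, hx, y, hy, hxy⟩ := hI'.exists_lt
  refine uniqueDiffOn_convex hI.convex
    ((?_ : (Set.Ioo x y).Nonempty).mono (interior_Icc (a := x) (b := y) ▸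
      interior_mono (hI.out hx hy)))
  exact Set.nonempty_Ioo.2 hxy

section LinearODE

variable {E : Type*} [NormedAddCommGroup E] [NormedSpace ℝ E] [CompleteSpace E]

theorem exp_smul_apply_exp_neg_smul (L : E →L[ℝ] E) (t : ℝ) (v : E) :
    NormedSpace.exp (t • L) (NormedSpace.exp (t • -L) v) = v := by
  let _ : NormedAlgebra ℚ (E →L[ℝ] E) := NormedAlgebra.restrictScalars ℚ ℝ _
  have h : NormedSpace.exp (t • L) * NormedSpace.exp (t • -L) = 1 := by
    rw [← NormedSpace.exp_add_of_commute, smul_neg, add_neg_cancel, NormedSpace.exp_zero]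
    rw [smul_neg]
    exact (Commute.refl _).neg_right
  exact congrArg (fun M : E →L[ℝ] E => M v) h

/-- Variation of constants. -/
theorem exists_hasDerivWithinAt_linear {I : Set ℝ} (hI : I.OrdConnected) (h0 : (0 : ℝ) ∈ I)
    (L : E →L[ℝ] E) {f : ℝ → E} (hf : ContinuousOn f I) (z₀ : E) :
    ∃ g : ℝ → E, g 0 = z₀ ∧ ∀ t ∈ I, HasDerivWithinAt g (L (g t) + f t) I t := by
  have hexp : ∀ (M : E →L[ℝ] E) (t : ℝ),
      HasDerivAt (fun r : ℝ => NormedSpace.exp (r • M)) (M * NormedSpace.exp (t • M)) t :=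
    fun M t => hasDerivAt_exp_smul_const' M t
  have hcont : ContinuousOn (fun t : ℝ => NormedSpace.exp (t • -L) (f t)) I :=
    ContinuousOn.clm_apply (fun t _ => (hexp (-L) t).continuousAt.continuousWithinAt) hf
  refine ⟨fun t => NormedSpace.exp (t • L)
    (z₀ + ∫ y in (0 : ℝ)..t, NormedSpace.exp (y • -L) (f y)), by simp, fun t ht => ?_⟩
  have h := (hexp L t).hasDerivWithinAt.clm_apply
    ((hasDerivWithinAt_integral hI hcont h0 ht).const_add z₀)
  rw [exp_smul_apply_exp_neg_smul] at h
  exact h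

theorem eq_zero_of_hasDerivWithinAt_linear {I : Set ℝ} (hI : I.OrdConnected) (h0 : (0 : ℝ) ∈ I)
    (L : E →L[ℝ] E) {g : ℝ → E} (hg : ∀ t ∈ I, HasDerivWithinAt g (L (g t)) I t)
    (hg0 : g 0 = 0) {t : ℝ} (ht : t ∈ I) : g t = 0 := by
  -- `exp(-tL) g(t)` has derivative zero
  have hd : ∀ t ∈ I, HasDerivWithinAt (fun r : ℝ => NormedSpace.exp (r • -L) (g r)) 0 I t := by
    intro t ht
    have h := (hasDerivAt_exp_smul_const (-L) t).hasDerivWithinAt.clm_apply (hg t ht)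
    simpa using h
  have h := Convex.norm_image_sub_le_of_norm_hasDerivWithin_le (C := 0) hd
    (fun _ _ => by simp) hI.convex h0 ht
  rw [zero_mul, norm_le_zero_iff, hg0, map_zero, sub_zero] at h
  rw [← exp_smul_apply_exp_neg_smul L t (g t), h, map_zero]

end LinearODE

/-! ### Solutions and filters of linear systems -/

/-- The constant input. -/
def constInput (I : Set ℝ) (c : ℝ) : C1 I ℝ :=
  ⟨fun _ => c, fun _ => c, contDiffOn_const, fun _ => rfl⟩

namespace LinSys

variable {ι κ : Type} [Fintype ι] [Fintype κ] {I : Set ℝ}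

theorem existsUnique_isSolution (hI : I.OrdConnected) (hI' : I.Nontrivial) (h0 : (0 : ℝ) ∈ I)
    (s : LinSys ι) (u : C1 I ℝ) (z₀ : ι → ℝ) :
    ∃! z : C1 I (ι → ℝ), s.IsSolution I u z₀ z := by
  have hU := uniqueDiffOn_of_ordConnected hI hI'
  obtain ⟨v, hv, huv⟩ := u.2
  let L : (ι → ℝ) →L[ℝ] (ι → ℝ) := (Matrix.mulVecLin s.A).toContinuousLinearMap
  obtain ⟨g, hg0, hg⟩ := exists_hasDerivWithinAt_linear hI h0 L
    (hv.continuousOn.smul continuousOn_const : ContinuousOn (fun t => v t • s.B) I) z₀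
  have hgc : ContDiffOn ℝ 1 g I := by
    rw [contDiffOn_one_iff_derivWithin hU]
    refine ⟨fun t ht => (hg t ht).differentiableWithinAt, ?_⟩
    refine ContinuousOn.congr (f := fun t => L (g t) + v t • s.B) ?_
      fun t ht => (hg t ht).derivWithin (hU t ht)
    exact (L.continuous.comp_continuousOn fun t ht => (hg t ht).continuousWithinAt).add
      (hv.continuousOn.smul continuousOn_const)
  refine ⟨⟨fun t => g t, g, hgc, fun _ => rfl⟩, ⟨?_, g, fun _ => rfl, fun t => ?_⟩, ?_⟩
  · intro t ht
    change g t = z₀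
    rw [ht, hg0]
  · rw [huv]
    exact hg t t.2
  · rintro z ⟨hz0, k, hzk, hk⟩
    refine Subtype.ext (funext fun t => ?_)
    change z.1 t = g t
    rw [hzk, ← sub_eq_zero]
    refine eq_zero_of_hasDerivWithinAt_linear (g := k - g) hI h0 L (fun r hr => ?_)
      ?_ t.2
    · have h := (hk ⟨r, hr⟩).sub (hg r hr)
      convert h using 1
      rw [hzk, huv]
      change L (k r - g r) = (L (k r) + v r • s.B) - (L (g r) + v r • s.B)
      rw [add_sub_add_right_eq_sub, map_sub]
    · have := hz0 ⟨0, h0⟩ rfl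
      rw [hzk] at this
      change k 0 = z₀ at this
      simp [this, hg0]

theorem filter_eq_output (hI : I.OrdConnected) (hI' : I.Nontrivial) (h0 : (0 : ℝ) ∈ I)
    {s : LinSys ι} {u : C1 I ℝ} {z₀ : ι → ℝ} {z : C1 I (ι → ℝ)} (hz : s.IsSolution I u z₀ z) :
    s.filter I u z₀ = s.output z := by
  unfold filter
  rw [(existsUnique_isSolution hI hI' h0 s u z₀).unique
    (Classical.epsilon_spec (p := fun z => s.IsSolution I u z₀ z) ⟨z, hz⟩) hz]

/-- Linear system morphisms transport solutions to solutions with the same output. -/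
theorem IsSystemMorphism.filter_eq (hI : I.OrdConnected) (hI' : I.Nontrivial) (h0 : (0 : ℝ) ∈ I)
    {s : LinSys ι} {t : LinSys κ} {f : (ι → ℝ) →ₗ[ℝ] (κ → ℝ)} (hf : IsSystemMorphism s t f)
    (u : C1 I ℝ) (z₀ : ι → ℝ) : t.filter I u (f z₀) = s.filter I u z₀ := by
  obtain ⟨z, hz, -⟩ := existsUnique_isSolution hI hI' h0 s u z₀
  let F := f.toContinuousLinearMap
  obtain ⟨k, hk, hzk⟩ := z.2
  let w : C1 I (κ → ℝ) := ⟨fun r => F (z.1 r), fun r => F (k r),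
    F.contDiff.comp_contDiffOn hk, fun r => congrArg F (hzk r)⟩
  have hw : t.IsSolution I u (f z₀) w := by
    obtain ⟨hz0, g, hzg, hg⟩ := hz
    refine ⟨fun r hr => congrArg F (hz0 r hr), fun r => F (g r),
      fun r => congrArg F (hzg r), fun r => ?_⟩
    have h := F.hasFDerivAt.comp_hasDerivWithinAt (r : ℝ) (hg r)
    have h' : F (s.stateMap (z.1 r) (u.1 r)) = t.stateMap (w.1 r) (u.1 r) := hf.1 _ _
    rw [← h']
    exact h
  rw [filter_eq_output hI hI' h0 hz, filter_eq_output hI hI' h0 hw]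
  exact Subtype.ext (funext fun r => (hf.2 (z.1 r)).symm)

variable [DecidableEq ι] [DecidableEq κ]

/-- If the outputs of two systems under the same constant input `c` agree, then so do all their
derivatives `C Aᵏ (A z₀ + c B)` at time `0`. -/
theorem readout_pow_eq_of_filter_const_eq (hI : I.OrdConnected) (hI' : I.Nontrivial)
    (h0 : (0 : ℝ) ∈ I) {s : LinSys ι} {t : LinSys κ} (c : ℝ) {z₀ : ι → ℝ} {w₀ : κ → ℝ}
    (h : s.filter I (constInput I c) z₀ = t.filter I (constInput I c) w₀) :
    s.C ⬝ᵥ z₀ = t.C ⬝ᵥ w₀ ∧ ∀ k, s.C ⬝ᵥ Matrix.mulVec (s.A ^ k) (s.stateMap z₀ c) =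
      t.C ⬝ᵥ Matrix.mulVec (t.A ^ k) (t.stateMap w₀ c) := by
  obtain ⟨z, hz, -⟩ := existsUnique_isSolution hI hI' h0 s (constInput I c) z₀
  obtain ⟨w, hw, -⟩ := existsUnique_isSolution hI hI' h0 t (constInput I c) w₀
  rw [filter_eq_output hI hI' h0 hz, filter_eq_output hI hI' h0 hw] at h
  obtain ⟨hz0, g, hzg, hg⟩ := hz
  obtain ⟨hw0, l, hwl, hl⟩ := hw
  have hgl : ∀ r ∈ I, s.C ⬝ᵥ g r = t.C ⬝ᵥ l r := fun r hr => by
    have := congrFun (congrArg Subtype.val h) ⟨r, hr⟩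
    change s.C ⬝ᵥ (z.1 ⟨r, hr⟩) = t.C ⬝ᵥ (w.1 ⟨r, hr⟩) at this
    rwa [hzg, hwl] at this
  have hg' : ∀ r ∈ I, HasDerivWithinAt g (s.stateMap (g r) c) I r := fun r hr => by
    have := hg ⟨r, hr⟩
    rwa [hzg] at this
  have hl' : ∀ r ∈ I, HasDerivWithinAt l (t.stateMap (l r) c) I r := fun r hr => by
    have := hl ⟨r, hr⟩
    rwa [hwl] at this
  have hU := uniqueDiffOn_of_ordConnected hI hI'
  have dot : ∀ {μ : Type} [Fintype μ] (v : μ → ℝ) {k : ℝ → μ → ℝ} {k' : μ → ℝ} {r : ℝ},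
      HasDerivWithinAt k k' I r → HasDerivWithinAt (fun x => v ⬝ᵥ k x) (v ⬝ᵥ k') I r := by
    intro μ _ v k k' r hk
    exact HasDerivWithinAt.fun_sum fun i _ => ((hasDerivWithinAt_pi.1 hk) i).const_mul (v i)
  have key : ∀ k, ∀ r ∈ I, s.C ⬝ᵥ Matrix.mulVec (s.A ^ k) (s.stateMap (g r) c) =
      t.C ⬝ᵥ Matrix.mulVec (t.A ^ k) (t.stateMap (l r) c) := by
    intro k
    induction k with
    | zero =>
      intro r hr
      simp only [pow_zero, Matrix.one_mulVec]
      refine UniqueDiffWithinAt.eq_deriv I (hU r hr) (dot s.C (hg' r hr)) ?_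
      exact (dot t.C (hl' r hr)).congr hgl (hgl r hr)
    | succ k ih =>
      intro r hr
      have expand : ∀ {μ : Type} [Fintype μ] [DecidableEq μ] (q : LinSys μ) (y : μ → ℝ),
          q.C ⬝ᵥ Matrix.mulVec (q.A ^ k) (q.stateMap y c) =
            Matrix.vecMul q.C (q.A ^ (k + 1)) ⬝ᵥ y
              + q.C ⬝ᵥ Matrix.mulVec (q.A ^ k) (c • q.B) := by
        intro μ _ _ q y
        unfold stateMap
        rw [Matrix.mulVec_add, dotProduct_add, Matrix.mulVec_mulVec, ← pow_succ,
          ← Matrix.dotProduct_mulVec]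
      simp only [expand] at ih
      have h1 := (dot (Matrix.vecMul s.C (s.A ^ (k + 1))) (hg' r hr)).add_const
        (s.C ⬝ᵥ Matrix.mulVec (s.A ^ k) (c • s.B))
      have h2 := (dot (Matrix.vecMul t.C (t.A ^ (k + 1))) (hl' r hr)).add_const
        (t.C ⬝ᵥ Matrix.mulVec (t.A ^ k) (c • t.B))
      rw [Matrix.dotProduct_mulVec, Matrix.dotProduct_mulVec]
      exact UniqueDiffWithinAt.eq_deriv I (hU r hr) h1 (h2.congr ih (ih r hr))
  have hg0 : g 0 = z₀ := by rw [← hz0 ⟨0, h0⟩ rfl, hzg]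
  have hl0 : l 0 = w₀ := by rw [← hw0 ⟨0, h0⟩ rfl, hwl]
  refine ⟨?_, fun k => ?_⟩
  · rw [← hg0, ← hl0]
    exact hgl 0 h0
  · rw [← hg0, ← hl0]
    exact key k 0 h0

/-- With zero input, the output determines all numbers `C Aᵏ z₀`. -/
theorem readout_pow_eq_of_filter_zero_eq (hI : I.OrdConnected) (hI' : I.Nontrivial)
    (h0 : (0 : ℝ) ∈ I) {s : LinSys ι} {t : LinSys κ} {z₀ : ι → ℝ} {w₀ : κ → ℝ}
    (h : s.filter I (constInput I 0) z₀ = t.filter I (constInput I 0) w₀) (k : ℕ) :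
    s.C ⬝ᵥ Matrix.mulVec (s.A ^ k) z₀ = t.C ⬝ᵥ Matrix.mulVec (t.A ^ k) w₀ := by
  obtain ⟨h1, h2⟩ := readout_pow_eq_of_filter_const_eq hI hI' h0 0 h
  cases k with
  | zero => simpa using h1
  | succ k => simpa [stateMap, Matrix.mulVec_mulVec, ← pow_succ] using h2 k

/-- The response to the constant input `1` from rest determines the Markov parameters. -/
theorem markov_eq_of_filter_eq (hI : I.OrdConnected) (hI' : I.Nontrivial)
    (h0 : (0 : ℝ) ∈ I) {s : LinSys ι} {t : LinSys κ}
    (h : s.filter I (constInput I 1) 0 = t.filter I (constInput I 1) 0) (k : ℕ) :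
    s.markov k = t.markov k := by
  obtain ⟨-, h2⟩ := readout_pow_eq_of_filter_const_eq hI hI' h0 1 h
  simpa [stateMap, markov] using h2 k

/-- The equivalences of canonical systems: each condition yields equal Markov parameters, hence an
isomorphism by the realization theorem. -/
theorem sysIso_tfae (hI : I.OrdConnected) (hI' : I.Nontrivial) (h0 : (0 : ℝ) ∈ I)
    {s : LinSys ι} {t : LinSys κ} (hs : s.IsCanonical) (ht : t.IsCanonical) :
    List.TFAE [
      SysIso s t,
      ∃ f : (ι → ℝ) ≃ (κ → ℝ), IsSystemMorphism s t f,
      ∃ f : (ι → ℝ) ≃ (κ → ℝ), ∀ u z₀, t.filter I u (f z₀) = s.filter I u z₀,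
      s.ioSystem I = t.ioSystem I,
      ∀ u, s.filter I u 0 = t.filter I u 0] := by
  tfae_have 1 → 2 := fun ⟨f, hf⟩ => ⟨f.toEquiv, hf⟩
  tfae_have 2 → 1 := fun ⟨f, hf⟩ => sysIso_of_markov_eq hs ht (hf.markov_eq (hf.map_zero ht.2))
  tfae_have 1 → 3 := fun ⟨f, hf⟩ =>
    ⟨f.toEquiv, IsSystemMorphism.filter_eq (f := f.toLinearMap) hI hI' h0 hf⟩
  tfae_have 3 → 4 := by
    rintro ⟨f, hf⟩
    unfold ioSystem
    simp_rw [← hf]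
    exact f.surjective.range_comp fun w₀ : κ → ℝ => fun u : C1 I ℝ => t.filter I u w₀
  tfae_have 4 → 5 := by
    intro h
    have hmem : (fun u => s.filter I u 0) ∈ t.ioSystem I := h ▸ ⟨0, rfl⟩
    obtain ⟨w₀, hw₀⟩ := hmem
    -- the output of `t` from `w₀` with zero input vanishes, so `w₀ = 0` by observability
    have hw : w₀ = 0 := (isObservable_iff t).1 ht.2 _ fun k => by
      rw [readout_pow_eq_of_filter_zero_eq hI hI' h0 (congrFun hw₀ (constInput I 0)) k]
      simp
    subst hw
    exact fun u => (congrFun hw₀ u).symm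
  tfae_have 5 → 1 := fun h =>
    sysIso_of_markov_eq hs ht (markov_eq_of_filter_eq hI hI' h0 (h _))
  tfae_finish

end LinSys

/-! ### Harmonic oscillators -/

/-- Linear functionals on polynomials that agree on the powers of `X` agree. -/
theorem functional_ext {f g : ℝ[X] →ₗ[ℝ] ℝ} (h : ∀ k, f (X ^ k) = g (X ^ k)) : f = g := by
  refine (Polynomial.basisMonomials ℝ).ext fun k => ?_
  rw [Polynomial.coe_basisMonomials]
  beta_reduce
  rw [← X_pow_eq_monomial]
  exact h k

/-- The functional `p ↦ Re ∑ⱼ aⱼ p(i dⱼ)` attached to frequencies `d` and complex amplitudes `a`.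
The Markov parameters of a system of oscillators are its values on the powers of `X`. -/
def osc {κ : Type*} [Fintype κ] (d : κ → ℝ) (a : κ → ℂ) : ℝ[X] →ₗ[ℝ] ℝ where
  toFun p := ∑ j, (a j * aeval ((d j : ℂ) * Complex.I) p).re
  map_add' p q := by simp [mul_add, Finset.sum_add_distrib]
  map_smul' c p := by
    rw [RingHom.id_apply, smul_eq_mul, Finset.mul_sum]
    refine Finset.sum_congr rfl fun j _ => ?_
    rw [map_smul, mul_smul_comm, Complex.smul_re, smul_eq_mul]

theorem osc_apply {κ : Type*} [Fintype κ] (d : κ → ℝ) (a : κ → ℂ) (p : ℝ[X]) :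
    osc d a p = ∑ j, (a j * aeval ((d j : ℂ) * Complex.I) p).re := rfl

theorem sq_ofReal_mul_I (r : ℝ) : ((r : ℂ) * Complex.I) ^ 2 = -((r ^ 2 : ℝ) : ℂ) := by
  rw [mul_pow, Complex.I_sq]
  push_cast
  ring

theorem re_pow_two_mul (r : ℝ) (m : ℕ) :
    (((r : ℂ) * Complex.I) ^ (2 * m)).re = (-1) ^ m * r ^ (2 * m) := by
  rw [pow_mul, sq_ofReal_mul_I, ← Complex.ofReal_neg, ← Complex.ofReal_pow, Complex.ofReal_re,
    neg_pow, ← pow_mul]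

theorem re_pow_two_mul_add_one (r : ℝ) (m : ℕ) :
    (((r : ℂ) * Complex.I) ^ (2 * m + 1)).re = 0 := by
  rw [pow_succ, pow_mul, sq_ofReal_mul_I, ← Complex.ofReal_neg, ← Complex.ofReal_pow,
    Complex.re_ofReal_mul]
  simp

/-- Oscillations with distinct positive frequencies are linearly independent. -/
theorem eq_zero_of_osc_eq_zero {κ : Type*} [Fintype κ] {d : κ → ℝ} {a : κ → ℂ}
    (hd : ∀ i, 0 < d i) (hinj : Function.Injective d) (h : ∀ k, osc d a (X ^ k) = 0) (i : κ) :
    a i = 0 := by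
  classical
  have h0 : osc d a = 0 := functional_ext fun k => by rw [h k]; rfl
  -- this polynomial vanishes at all `i dⱼ` except `i dᵢ`, where it is real
  let p : ℝ[X] := ∏ j ∈ Finset.univ.erase i, (X ^ 2 + C (d j ^ 2))
  have hp : ∀ k, aeval ((d k : ℂ) * Complex.I) p =
      ((∏ j ∈ Finset.univ.erase i, (d j ^ 2 - d k ^ 2) : ℝ) : ℂ) := fun k => by
    simp only [p, map_prod, map_add, map_pow, aeval_X, aeval_C, sq_ofReal_mul_I]
    push_cast
    refine Finset.prod_congr rfl fun j _ => ?_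
    simp
    ring
  have hne : ∀ k, k ≠ i → aeval ((d k : ℂ) * Complex.I) p = 0 := fun k hk => by
    rw [hp, Finset.prod_eq_zero (i := k) (by simpa using hk) (sub_self _), Complex.ofReal_zero]
  have hr : (∏ j ∈ Finset.univ.erase i, (d j ^ 2 - d i ^ 2)) ≠ 0 := by
    refine Finset.prod_ne_zero_iff.2 fun j hj => sub_ne_zero.2 fun hc => Finset.ne_of_mem_erase hj ?_
    exact hinj ((pow_left_inj₀ (hd j).le (hd i).le two_ne_zero).1 hc)
  have key : ∀ q : ℝ[X], (a i * aeval ((d i : ℂ) * Complex.I) q).re = 0 := fun q => by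
    have h1 : osc d a (q * p) = 0 := by rw [h0]; rfl
    rw [osc_apply, Finset.sum_eq_single i] at h1
    · rw [map_mul, hp i, ← mul_assoc, Complex.re_mul_ofReal] at h1
      exact (mul_eq_zero.1 h1).resolve_right hr
    · intro k _ hk
      rw [map_mul, hne k hk]
      simp
    · simp
  have k1 := key 1
  have k2 := key X
  refine Complex.ext (by simpa using k1) ?_
  have : (a i).re = 0 := by simpa using k1
  simpa [this, (hd i).ne'] using k2

/-- The squared amplitude `vᵢ² + vₙ₊ᵢ²`. -/
def weight {n : ℕ} (x : Par n) (i : Fin n) : ℝ := x.2 (Sum.inl i) ^ 2 + x.2 (Sum.inr i) ^ 2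

theorem weight_nonneg {n : ℕ} (x : Par n) (i : Fin n) : 0 ≤ weight x i := by
  unfold weight; positivity

/-- Distinct positive frequencies, all of them excited. -/
structure Generic {n : ℕ} (x : Par n) : Prop where
  pos : ∀ i, 0 < x.1 i
  injective : Function.Injective x.1
  weight_pos : ∀ i, 0 < weight x i

/-- The port-Hamiltonian system of `n` decoupled oscillators. -/
def diagSystem {n : ℕ} (x : Par n) : LinSys (Fin n ⊕ Fin n) :=
  phSystem (Matrix.fromBlocks (Matrix.diagonal x.1) 0 0 (Matrix.diagonal x.1), x.2)

/-- The complex coordinates `zₙ₊ᵢ + i zᵢ`, in which a decoupled oscillator is the multiplication by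
`i dᵢ`. -/
def cplx {n : ℕ} (z : Fin n ⊕ Fin n → ℝ) (i : Fin n) : ℂ := ⟨z (Sum.inr i), z (Sum.inl i)⟩

theorem cplx_eq_zero {n : ℕ} {z : Fin n ⊕ Fin n → ℝ} (h : ∀ i, cplx z i = 0) : z = 0 := by
  funext i
  rcases i with i | i
  · exact congrArg Complex.im (h i)
  · exact congrArg Complex.re (h i)

theorem dotProduct_eq_cplx {n : ℕ} (y z : Fin n ⊕ Fin n → ℝ) :
    y ⬝ᵥ z = ∑ i, (star (cplx y i) * cplx z i).re := by
  simp only [dotProduct, Fintype.sum_sum_type, ← Finset.sum_add_distrib]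
  refine Finset.sum_congr rfl fun i _ => ?_
  simp [cplx]
  ring

theorem JJ_mul_fromBlocks_diagonal {n : ℕ} (d : Fin n → ℝ) :
    JJ n * Matrix.fromBlocks (Matrix.diagonal d) 0 0 (Matrix.diagonal d) =
      Matrix.fromBlocks 0 (Matrix.diagonal d) (-Matrix.diagonal d) 0 := by
  rw [JJ, Matrix.fromBlocks_multiply]
  simp

theorem cplx_diagSystem_mulVec {n : ℕ} (x : Par n) (z : Fin n ⊕ Fin n → ℝ) (i : Fin n) :
    cplx (Matrix.mulVec (diagSystem x).A z) i = ((x.1 i : ℂ) * Complex.I) * cplx z i := by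
  change cplx (Matrix.mulVec (JJ n * _) z) i = _
  rw [JJ_mul_fromBlocks_diagonal, Matrix.fromBlocks_mulVec]
  apply Complex.ext <;> simp [cplx, Matrix.mulVec_diagonal]

theorem cplx_diagSystem_pow_mulVec {n : ℕ} (x : Par n) (z : Fin n ⊕ Fin n → ℝ) (i : Fin n)
    (k : ℕ) : cplx (Matrix.mulVec ((diagSystem x).A ^ k) z) i =
      ((x.1 i : ℂ) * Complex.I) ^ k * cplx z i := by
  induction k with
  | zero => simp
  | succ k ih =>
    rw [pow_succ', ← Matrix.mulVec_mulVec, cplx_diagSystem_mulVec, ih]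
    ring

theorem cplx_diagSystem_C {n : ℕ} (x : Par n) (i : Fin n) :
    cplx (diagSystem x).C i = x.1 i * cplx x.2 i := by
  change cplx (Matrix.vecMul x.2 _) i = _
  rw [Matrix.vecMul_fromBlocks]
  apply Complex.ext <;> simp [cplx, Matrix.vecMul_diagonal, mul_comm]

theorem star_cplx_mul_self {n : ℕ} (x : Par n) (i : Fin n) :
    star (cplx x.2 i) * cplx x.2 i = (weight x i : ℂ) := by
  apply Complex.ext
  · simp only [Complex.ofReal_re]
    simp [cplx, weight]
    ring
  · simp [cplx]; ring

theorem dotProduct_diagSystem_pow {n : ℕ} (x : Par n) (y z : Fin n ⊕ Fin n → ℝ) (k : ℕ) :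
    y ⬝ᵥ Matrix.mulVec ((diagSystem x).A ^ k) z =
      osc x.1 (fun i => star (cplx y i) * cplx z i) (X ^ k) := by
  rw [dotProduct_eq_cplx, osc_apply]
  refine Finset.sum_congr rfl fun i _ => ?_
  rw [cplx_diagSystem_pow_mulVec, map_pow, aeval_X]
  congr 1
  ring

theorem diagSystem_markov {n : ℕ} (x : Par n) (k : ℕ) :
    (diagSystem x).markov k = osc x.1 (fun i => (x.1 i * weight x i : ℝ)) (X ^ k) := by
  unfold LinSys.markov
  rw [dotProduct_diagSystem_pow]
  congr 2
  funext i
  change star (cplx (diagSystem x).C i) * cplx x.2 i = _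
  rw [cplx_diagSystem_C, star_mul', mul_assoc, star_cplx_mul_self]
  simp

theorem Generic.cplx_ne_zero {n : ℕ} {x : Par n} (hx : Generic x) (i : Fin n) :
    cplx x.2 i ≠ 0 := fun h => by
  have := star_cplx_mul_self x i
  rw [h, mul_zero] at this
  exact (hx.weight_pos i).ne (by exact_mod_cast this)

theorem Generic.diagSystem_isCanonical {n : ℕ} {x : Par n} (hx : Generic x) :
    (diagSystem x).IsCanonical := by
  refine ⟨(LinSys.isControllable_iff _).2 fun y hy => cplx_eq_zero fun i => ?_,
    (LinSys.isObservable_iff _).2 fun z hz => cplx_eq_zero fun i => ?_⟩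
  · have h := eq_zero_of_osc_eq_zero hx.pos hx.injective
      (fun k => (dotProduct_diagSystem_pow x y _ k).symm.trans (hy k)) i
    simpa using (mul_eq_zero.1 h).resolve_right (hx.cplx_ne_zero i)
  · have h := eq_zero_of_osc_eq_zero hx.pos hx.injective
      (fun k => (dotProduct_diagSystem_pow x _ z k).symm.trans (hz k)) i
    rw [cplx_diagSystem_C] at h
    refine (mul_eq_zero.1 h).resolve_left ?_
    simp [hx.cplx_ne_zero i, (hx.pos i).ne']

/-! ### Grouping equal frequencies -/

/-- A nonnegative combination of oscillations can be rewritten with distinct frequencies and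
positive amplitudes. -/
theorem exists_generic_osc {κ : Type*} [Fintype κ] (d c : κ → ℝ) (hd : ∀ j, 0 < d j)
    (hc : ∀ j, 0 ≤ c j) : ∃ x : Par ((Finset.univ.filter fun j => c j ≠ 0).image d).card,
      Generic x ∧ ∀ p, osc x.1 (fun i => (x.1 i * weight x i : ℝ)) p =
        osc d (fun j => (c j : ℂ)) p := by
  classical
  set S := Finset.univ.filter fun j => c j ≠ 0 with hS
  set D := S.image d with hD
  let e : D ≃ Fin D.card := D.equivFin
  let f : Fin D.card → ℝ := fun i => (e.symm i : ℝ)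
  have hfpos : ∀ i, 0 < f i := fun i => by
    obtain ⟨j, -, hj⟩ := Finset.mem_image.1 (e.symm i).2
    exact (hd j).trans_eq hj
  let g : ℝ → ℝ := fun r => ∑ j ∈ S.filter fun j => d j = r, c j
  have hgpos : ∀ r ∈ D, 0 < g r := fun r hr => by
    obtain ⟨j, hj, hjr⟩ := Finset.mem_image.1 hr
    refine Finset.sum_pos (fun i hi => ?_) ⟨j, Finset.mem_filter.2 ⟨hj, hjr⟩⟩
    exact (hc i).lt_of_ne (Finset.mem_filter.1 (Finset.mem_filter.1 hi).1).2.symm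
  -- amplitudes realizing the mass `g r` at each frequency `r`, since `d w = g`
  let x : Par D.card := (f, Sum.elim (fun i => √(g (f i) / f i)) 0)
  have hw : ∀ i, x.1 i * weight x i = g (f i) := fun i => by
    have h1 : 0 ≤ g (f i) / f i := (div_pos (hgpos _ (e.symm i).2) (hfpos i)).le
    have h2 : weight x i = g (f i) / f i := by simp [weight, x, Real.sq_sqrt h1]
    rw [h2]
    exact mul_div_cancel₀ _ (hfpos i).ne'
  refine ⟨x, ⟨hfpos, Subtype.val_injective.comp e.symm.injective, fun i => ?_⟩, fun p => ?_⟩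
  · have h := hw i
    have h1 := hgpos _ (e.symm i).2
    refine (weight_nonneg x i).lt_of_ne fun h0 => ?_
    rw [← h0, mul_zero] at h
    exact h1.ne h
  · rw [osc_apply, osc_apply]
    simp only [hw, Complex.re_ofReal_mul]
    change ∑ i, g (e.symm i : ℝ) * (aeval (((e.symm i : ℝ) : ℂ) * Complex.I) p).re = _
    rw [Equiv.sum_comp e.symm fun r : D => g r * (aeval (((r : ℝ) : ℂ) * Complex.I) p).re,
      Finset.sum_coe_sort D fun r => g r * (aeval ((r : ℂ) * Complex.I) p).re]
    have h1 : ∑ j, c j * (aeval ((d j : ℂ) * Complex.I) p).re =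
        ∑ j ∈ S, c j * (aeval ((d j : ℂ) * Complex.I) p).re := by
      refine (Finset.sum_subset (Finset.subset_univ S) fun j _ hj => ?_).symm
      have : c j = 0 := by simpa [hS] using hj
      rw [this, zero_mul]
    rw [h1, ← Finset.sum_fiberwise_of_maps_to (t := D) (g := d)
      fun j hj => Finset.mem_image_of_mem d hj]
    refine Finset.sum_congr rfl fun r _ => ?_
    rw [Finset.sum_mul]
    refine Finset.sum_congr rfl fun j hj => ?_
    rw [(Finset.mem_filter.1 hj).2]

/-- A canonical system whose Markov parameters are those of oscillators is isomorphic to a system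
of decoupled oscillators with distinct frequencies, whose number is thus half the dimension. -/
theorem exists_sysIso_diagSystem {ι κ : Type} [Fintype ι] [DecidableEq ι] [Fintype κ]
    {s : LinSys ι} (hs : s.IsCanonical) (d c : κ → ℝ) (hd : ∀ j, 0 < d j) (hc : ∀ j, 0 ≤ c j)
    (h : ∀ k, s.markov k = osc d (fun j => (c j : ℂ)) (X ^ k)) :
    Fintype.card ι = 2 * ((Finset.univ.filter fun j => c j ≠ 0).image d).card ∧
    ∃ x : Par ((Finset.univ.filter fun j => c j ≠ 0).image d).card,
      Generic x ∧ LinSys.SysIso s (diagSystem x) := by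
  obtain ⟨x, hx, hosc⟩ := exists_generic_osc d c hd hc
  have hiso : LinSys.SysIso s (diagSystem x) :=
    LinSys.sysIso_of_markov_eq hs hx.diagSystem_isCanonical fun k => by
      rw [h, diagSystem_markov, hosc]
  refine ⟨?_, x, hx, hiso⟩
  rw [hiso.card_eq, Fintype.card_sum, Fintype.card_fin, two_mul]

/-! ### Canonical port-Hamiltonian systems are decoupled oscillators -/

theorem dotProduct_mulVec_pow_eq_sum {ι : Type*} [Fintype ι] [DecidableEq ι]
    {T : Matrix ι ι ℝ} (hT : T.IsHermitian) (y : ι → ℝ) (m : ℕ) :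
    y ⬝ᵥ Matrix.mulVec (T ^ m) y = ∑ j, hT.eigenvalues j ^ m *
      Matrix.mulVec (star (hT.eigenvectorUnitary : Matrix ι ι ℝ)) y j ^ 2 := by
  have h : T ^ m = (hT.eigenvectorUnitary : Matrix ι ι ℝ) *
      Matrix.diagonal (fun j => hT.eigenvalues j ^ m) *
        star (hT.eigenvectorUnitary : Matrix ι ι ℝ) := by
    conv_lhs => rw [hT.spectral_theorem, ← map_pow, Matrix.diagonal_pow]
    rw [Unitary.conjStarAlgAut_apply]
    rfl
  rw [h, Matrix.mul_assoc, ← Matrix.mulVec_mulVec, ← Matrix.mulVec_mulVec, Matrix.dotProduct_mulVec,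
    ← Matrix.mulVec_transpose]
  simp only [dotProduct, Matrix.mulVec_diagonal]
  refine Finset.sum_congr rfl fun j _ => ?_
  rw [Matrix.star_eq_conjTranspose, Matrix.conjTranspose_eq_transpose_of_trivial]
  ring

/-- Write `Q = MᵀM`. In the coordinates `M z` the system matrix is the invertible skew-symmetric
`K = M J Mᵀ`, and an orthonormal eigenbasis of the positive definite `KᵀK = -K²` exhibits the Markov
parameters as those of oscillators. -/
theorem exists_osc_of_posDef {n : ℕ}
    {p : Matrix (Fin n ⊕ Fin n) (Fin n ⊕ Fin n) ℝ × (Fin n ⊕ Fin n → ℝ)} (hp : p ∈ ThetaPH n) :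
    ∃ d c : Fin n ⊕ Fin n → ℝ, (∀ j, 0 < d j) ∧ (∀ j, 0 ≤ c j) ∧
      ∀ k, (phSystem p).markov k = osc d (fun j => (c j : ℂ)) (X ^ k) := by
  obtain ⟨Q, B⟩ := p
  have hQ : Q.PosDef := hp
  obtain ⟨M, hM⟩ : ∃ M : Matrix (Fin n ⊕ Fin n) (Fin n ⊕ Fin n) ℝ, Q = M.transpose * M := by
    open scoped MatrixOrder in
    obtain ⟨M, hM⟩ := CStarAlgebra.nonneg_iff_eq_star_mul_self.mp hQ.posSemidef.nonneg
    exact ⟨M, by rw [hM, Matrix.star_eq_conjTranspose,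
      Matrix.conjTranspose_eq_transpose_of_trivial]⟩
  have hJt : (JJ n).transpose = -JJ n := by
    simp [JJ, Matrix.fromBlocks_transpose, Matrix.fromBlocks_neg]
  have hJJ : JJ n * JJ n = -1 := by
    rw [JJ, Matrix.fromBlocks_multiply, ← Matrix.fromBlocks_one, Matrix.fromBlocks_neg]
    simp
  have hMdet : M.det ≠ 0 := fun h0 => hQ.det_pos.ne' (by rw [hM, Matrix.det_mul, h0, mul_zero])
  have hJdet : (JJ n).det ≠ 0 := fun h0 => by
    have h1 : (JJ n * JJ n * -1).det = 1 := by rw [hJJ]; simp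
    rw [Matrix.det_mul, Matrix.det_mul, h0] at h1
    simp at h1
  set K := M * JJ n * M.transpose with hK
  have hKt : K.transpose = -K := by
    rw [hK, Matrix.transpose_mul, Matrix.transpose_mul, Matrix.transpose_transpose, hJt]
    simp [Matrix.mul_assoc]
  have hKdet : K.det ≠ 0 := by
    rw [hK, Matrix.det_mul, Matrix.det_mul, Matrix.det_transpose]
    exact mul_ne_zero (mul_ne_zero hMdet hJdet) hMdet
  have hT : (K.transpose * K).PosDef := by
    rw [← Matrix.conjTranspose_eq_transpose_of_trivial]
    refine Matrix.PosDef.conjTranspose_mul_self K (Matrix.mulVec_injective_iff_isUnit.2 ?_)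
    exact (Matrix.isUnit_iff_isUnit_det K).2 hKdet.isUnit
  set b := Matrix.mulVec M B with hb
  have hmarkov : ∀ k, (phSystem (Q, B)).markov k = b ⬝ᵥ Matrix.mulVec (K ^ k) b := fun k => by
    have hsemi : M * (JJ n * Q) ^ k = K ^ k * M := by
      refine (SemiconjBy.pow_right ?_ k : SemiconjBy M _ _)
      change M * (JJ n * Q) = K * M
      rw [hM, hK]
      simp only [Matrix.mul_assoc]
    change Matrix.vecMul B Q ⬝ᵥ Matrix.mulVec ((JJ n * Q) ^ k) B = _
    have hform : ∀ w, B ⬝ᵥ Matrix.mulVec Q w = Matrix.mulVec M B ⬝ᵥ Matrix.mulVec M w := fun w => by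
      rw [hM, ← Matrix.mulVec_mulVec, Matrix.dotProduct_mulVec B, Matrix.vecMul_transpose]
    rw [hb, Matrix.mulVec_mulVec, ← hsemi, ← Matrix.dotProduct_mulVec, hform,
      Matrix.mulVec_mulVec]
  refine ⟨fun j => √(hT.1.eigenvalues j), fun j =>
    Matrix.mulVec (star (hT.1.eigenvectorUnitary : Matrix _ _ ℝ)) b j ^ 2,
    fun j => Real.sqrt_pos.2 (hT.eigenvalues_pos j), fun j => sq_nonneg _, fun k => ?_⟩
  rw [hmarkov, osc_apply]
  simp only [Complex.re_ofReal_mul, map_pow, aeval_X]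
  rcases Nat.even_or_odd' k with ⟨m, rfl | rfl⟩
  · have hpow : K ^ (2 * m) = (-1 : ℝ) ^ m • (K.transpose * K) ^ m := by
      rw [pow_mul, pow_two, hKt, neg_mul, ← neg_one_smul ℝ (K * K), _root_.smul_pow, smul_smul,
        ← mul_pow]
      simp
    rw [hpow, Matrix.smul_mulVec, dotProduct_smul, dotProduct_mulVec_pow_eq_sum hT.1, smul_eq_mul,
      Finset.mul_sum]
    refine Finset.sum_congr rfl fun j _ => ?_
    rw [re_pow_two_mul, pow_mul, Real.sq_sqrt (hT.eigenvalues_pos j).le]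
    ring
  · -- odd powers of `K` are skew-symmetric
    have hskew : (K ^ (2 * m + 1)).transpose = -K ^ (2 * m + 1) := by
      rw [Matrix.transpose_pow, hKt, Odd.neg_pow ⟨m, rfl⟩]
    have h1 : b ⬝ᵥ Matrix.mulVec (K ^ (2 * m + 1)) b =
        -(b ⬝ᵥ Matrix.mulVec (K ^ (2 * m + 1)) b) := by
      conv_lhs => rw [Matrix.dotProduct_mulVec, ← Matrix.mulVec_transpose, hskew, dotProduct_comm]
      rw [Matrix.neg_mulVec, dotProduct_neg]
    simp only [re_pow_two_mul_add_one, mul_zero, Finset.sum_const_zero]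
    linarith

theorem exists_generic_sysIso_of_mem_PHcan {n : ℕ} {s : LinSys (Fin n ⊕ Fin n)}
    (hs : s ∈ PHcan n) : ∃ x : Par n, Generic x ∧ LinSys.SysIso s (diagSystem x) := by
  obtain ⟨⟨p, hp, rfl⟩, hcan⟩ := hs
  obtain ⟨d, c, hd, hc, h⟩ := exists_osc_of_posDef hp
  obtain ⟨hcard, hx⟩ := exists_sysIso_diagSystem hcan d c hd hc h
  have hn : ((Finset.univ.filter fun j => c j ≠ 0).image d).card = n := by
    rw [Fintype.card_sum, Fintype.card_fin] at hcard
    omega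
  rwa [hn] at hx

theorem fromBlocks_diagonal_posDef {n : ℕ} {d : Fin n → ℝ} (hd : ∀ i, 0 < d i) :
    (Matrix.fromBlocks (Matrix.diagonal d) 0 0 (Matrix.diagonal d)).PosDef := by
  rw [Matrix.fromBlocks_diagonal]
  exact Matrix.PosDef.diagonal fun i => by rcases i with i | i <;> exact hd i

theorem mem_symplecticGroup_iff_JJ {n : ℕ} {S : Matrix (Fin n ⊕ Fin n) (Fin n ⊕ Fin n) ℝ} :
    S ∈ Matrix.symplecticGroup (Fin n) ℝ ↔ S * JJ n * S.transpose = JJ n := by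
  have h : JJ n = -Matrix.J (Fin n) ℝ := by
    simp [JJ, Matrix.J, Matrix.fromBlocks_neg]
  rw [SymplecticGroup.mem_iff, h]
  simp

theorem phiS_mem_PH {n : ℕ} {S : Matrix (Fin n ⊕ Fin n) (Fin n ⊕ Fin n) ℝ}
    (hS : S ∈ Matrix.symplecticGroup (Fin n) ℝ) {x : Par n} (hx : ∀ i, 0 < x.1 i) :
    phiS S x ∈ PH n := by
  refine ⟨_, ?_, rfl⟩
  change Matrix.PosDef _
  rw [← Matrix.conjTranspose_eq_transpose_of_trivial]
  exact (fromBlocks_diagonal_posDef hx).conjTranspose_mul_mul_same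
    (Matrix.mulVec_injective_iff_isUnit.2
      ((Matrix.isUnit_iff_isUnit_det S).2 (SymplecticGroup.symplectic_det hS)))

/-- The symplectic change of coordinates `S` decouples the oscillators. -/
theorem phiS_sysIso_diagSystem {n : ℕ} {S : Matrix (Fin n ⊕ Fin n) (Fin n ⊕ Fin n) ℝ}
    (hS : S ∈ Matrix.symplecticGroup (Fin n) ℝ) (x : Par n) :
    LinSys.SysIso (phiS S x) (diagSystem x) := by
  have hdet := SymplecticGroup.symplectic_det hS
  have hJ := mem_symplecticGroup_iff_JJ.1 hS
  refine ⟨Matrix.toLinearEquiv' S (Matrix.invertibleOfIsUnitDet S hdet), fun z u => ?_, fun z => ?_⟩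
  · change Matrix.mulVec S (Matrix.mulVec (JJ n * (S.transpose * _ * S)) z +
      u • Matrix.mulVec S⁻¹ x.2) = Matrix.mulVec (JJ n * _) (Matrix.mulVec S z) + u • x.2
    rw [Matrix.mulVec_add, Matrix.mulVec_smul, Matrix.mulVec_mulVec, Matrix.mulVec_mulVec,
      Matrix.mul_nonsing_inv S hdet, Matrix.one_mulVec, Matrix.mulVec_mulVec]
    congr 2
    conv_rhs => rw [← hJ]
    simp only [Matrix.mul_assoc]
  · change Matrix.vecMul (Matrix.mulVec S⁻¹ x.2) (S.transpose * _ * S) ⬝ᵥ z =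
      Matrix.vecMul x.2 _ ⬝ᵥ Matrix.mulVec S z
    rw [Matrix.dotProduct_mulVec, Matrix.vecMul_vecMul, Matrix.mul_assoc, ← Matrix.vecMul_vecMul,
      Matrix.vecMul_transpose, Matrix.mulVec_mulVec, Matrix.mul_nonsing_inv S hdet,
      Matrix.one_mulVec]

/-! ### Companion matrices and controllable Hamiltonian representations -/

/-- The companion matrix with last row `-a₀, …, -a_{N-1}`. -/
def companion (N : ℕ) (a : ℕ → ℝ) : Matrix (Fin N) (Fin N) ℝ :=
  Matrix.of fun i j => if (i : ℕ) + 1 = N then -a j else if (j : ℕ) = i + 1 then 1 else 0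

/-- The last unit vector. -/
def lastUnit (N : ℕ) : Fin N → ℝ := fun i => if (i : ℕ) + 1 = N then 1 else 0

theorem dotProduct_lastUnit {N : ℕ} (y : Fin N → ℝ) (i : Fin N) (hi : (i : ℕ) + 1 = N) :
    y ⬝ᵥ lastUnit N = y i := by
  have : ∀ j : Fin N, ((j : ℕ) + 1 = N) = (j = i) := fun j => by
    rw [Fin.ext_iff, eq_iff_iff]; omega
  simp [dotProduct, lastUnit, this]

theorem vecMul_companion_zero {N : ℕ} (a : ℕ → ℝ) (y : Fin N → ℝ) (h : 0 < N) :
    Matrix.vecMul y (companion N a) ⟨0, h⟩ = -a 0 * y ⟨N - 1, by omega⟩ := by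
  rw [Matrix.vecMul, dotProduct, Finset.sum_eq_single ⟨N - 1, by omega⟩]
  · have : N - 1 + 1 = N := by omega
    simp [companion, this, mul_comm]
  · intro i _ hi
    have : (i : ℕ) + 1 ≠ N := fun hc => hi (Fin.ext (by simp; omega))
    simp [companion, this]
  · simp

theorem vecMul_companion_succ {N : ℕ} (a : ℕ → ℝ) (y : Fin N → ℝ) (j : ℕ) (h : j + 1 < N) :
    Matrix.vecMul y (companion N a) ⟨j + 1, h⟩ =
      y ⟨j, by omega⟩ - a (j + 1) * y ⟨N - 1, by omega⟩ := by
  have key : ∀ i : Fin N, y i * companion N a i ⟨j + 1, h⟩ =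
      (if i = ⟨j, by omega⟩ then y i else 0)
        - (if i = ⟨N - 1, by omega⟩ then a (j + 1) * y i else 0) := by
    intro i
    simp only [companion, Matrix.of_apply, Fin.ext_iff]
    by_cases h1 : (i : ℕ) + 1 = N
    · rw [if_pos h1, if_neg (by omega), if_pos (by omega)]
      ring
    · rw [if_neg h1, if_neg (c := (i : ℕ) = N - 1) (by omega)]
      by_cases h2 : (i : ℕ) = j
      · rw [if_pos (by omega), if_pos h2]; ring
      · rw [if_neg (by omega), if_neg h2]; ring
  rw [Matrix.vecMul, dotProduct, Finset.sum_congr rfl fun i _ => key i, Finset.sum_sub_distrib]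
  simp

/-- The companion form is controllable: a row vector orthogonal to all `Aᵏ B` vanishes, coordinate
by coordinate from the last one. -/
theorem companion_isControllable {N : ℕ} (a : ℕ → ℝ) (c : Fin N → ℝ) :
    (LinSys.mk (companion N a) (lastUnit N) c).IsControllable := by
  refine (LinSys.isControllable_iff _).2 ?_
  have key : ∀ m (hm : m < N), ∀ y : Fin N → ℝ,
      (∀ k, y ⬝ᵥ Matrix.mulVec (companion N a ^ k) (lastUnit N) = 0) →
        y ⟨N - 1 - m, by omega⟩ = 0 := by
    intro m
    induction m with
    | zero =>
      intro hm y hy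
      rw [← dotProduct_lastUnit y _ (by simp; omega)]
      simpa using hy 0
    | succ m ih =>
      intro hm y hy
      have h0 : y ⟨N - 1, by omega⟩ = 0 := by
        rw [← dotProduct_lastUnit y _ (by simp; omega)]
        simpa using hy 0
      have h1 := ih (by omega) (Matrix.vecMul y (companion N a)) fun k => by
        rw [← Matrix.dotProduct_mulVec, Matrix.mulVec_mulVec, ← pow_succ']
        exact hy (k + 1)
      have h2 : N - 1 - m = N - 1 - (m + 1) + 1 := by omega
      have h3 := vecMul_companion_succ a y (N - 1 - (m + 1)) (by omega)
      rw [h0, mul_zero, sub_zero] at h3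
      rw [← h3, ← h1]
      congr 1
      exact Fin.ext h2.symm
  intro y hy
  funext i
  have hi : (⟨N - 1 - (N - 1 - i), by omega⟩ : Fin N) = i := Fin.ext (by simp; omega)
  rw [← hi]
  exact key (N - 1 - i) (by omega) y hy

theorem coeff_divX_iterate {R : Type*} [Semiring R] (p : R[X]) (k m : ℕ) :
    (divX^[k] p).coeff m = p.coeff (m + k) := by
  induction k generalizing p with
  | zero => rfl
  | succ k ih => rw [Function.iterate_succ_apply, ih, coeff_divX]; congr 1

theorem X_mul_divX_iterate_succ {R : Type*} [CommRing R] (p : R[X]) (k : ℕ) :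
    X * divX^[k + 1] p = divX^[k] p - C (p.coeff k) := by
  have h := X_mul_divX_add (divX^[k] p)
  rw [coeff_divX_iterate, zero_add] at h
  rw [Function.iterate_succ_apply', eq_sub_iff_add_eq, h]

/-- Realization in companion form: if a functional `ℓ` on polynomials vanishes on the multiples of
the monic `p`, then the values of `ℓ` on the polynomial parts of `p / X^{j+1}`, taken as the readout
of the companion system of `p`, give a system with Markov parameters `ℓ(Xᵏ)`. -/
theorem companion_markov {N : ℕ} {p : ℝ[X]} (hp : p.Monic) (hN : p.natDegree = N) (hN0 : 0 < N)
    (l : ℝ[X] →ₗ[ℝ] ℝ) (hl : ∀ q, l (q * p) = 0) (c : Fin N → ℝ)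
    (hc : ∀ j : Fin N, c j = l (divX^[j + 1] p)) (k : ℕ) :
    (LinSys.mk (companion N p.coeff) (lastUnit N) c).markov k = l (X ^ k) := by
  have hlast : divX^[N] p = 1 := by
    ext m
    rw [coeff_divX_iterate, coeff_one]
    by_cases hm : m = 0
    · rw [if_pos hm, hm, zero_add, ← hN]
      exact hp.coeff_natDegree
    · rw [if_neg hm]
      exact coeff_eq_zero_of_natDegree_lt (by omega)
  have hC : ∀ r a, l (r * C a) = a * l r := fun r a => by
    rw [mul_comm, C_mul', map_smul, smul_eq_mul]
  have row : ∀ k (j : ℕ) (hj : j < N),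
      Matrix.vecMul c (companion N p.coeff ^ k) ⟨j, hj⟩ = l (X ^ k * divX^[j + 1] p) := by
    intro k
    induction k with
    | zero => intro j hj; simp [hc]
    | succ k ih =>
      intro j hj
      rw [pow_succ, ← Matrix.vecMul_vecMul, pow_succ, mul_assoc, X_mul_divX_iterate_succ, mul_sub,
        map_sub, hC]
      have h1 := ih (N - 1) (by omega)
      rw [Nat.sub_add_cancel hN0, hlast, mul_one] at h1
      cases j with
      | zero =>
        rw [vecMul_companion_zero, h1]
        have : l (X ^ k * divX^[0] p) = 0 := hl _
        rw [this]
        ring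
      | succ j => rw [vecMul_companion_succ, h1, ih]
  have h1 := row k (N - 1) (by omega)
  rw [Nat.sub_add_cancel hN0, hlast, mul_one] at h1
  rw [LinSys.markov, Matrix.dotProduct_mulVec]
  exact (dotProduct_lastUnit _ ⟨N - 1, by omega⟩ (by simp; omega)).trans h1

/-- Synthetic division by `X - α`. -/
theorem eval_divX_iterate_succ_X_sub_C_mul {R : Type*} [CommRing R] (α : R) (q : R[X]) (k : ℕ) :
    (divX^[k + 1] ((X - C α) * q)).eval α = q.coeff k := by
  have h : divX^[k + 1] ((X - C α) * q) = (X - C α) * divX^[k + 1] q + C (q.coeff k) := by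
    rw [sub_mul, sub_mul, X_mul_divX_iterate_succ]
    ext m
    simp only [coeff_divX_iterate, coeff_add, coeff_sub, coeff_C_mul]
    rw [← add_assoc, coeff_X_mul]
    ring_nf
  rw [h]
  simp

theorem map_divX_iterate {R S : Type*} [Semiring R] [Semiring S] (f : R →+* S) (p : R[X]) (k : ℕ) :
    (divX^[k] p).map f = divX^[k] (p.map f) := by
  ext m
  simp [coeff_divX_iterate]

/-- The product of `X + dⱼ²` over `j ≠ i`; at `X = λ²` it is `dPoly d / (λ² + dᵢ²)`. -/
def otherPoly {n : ℕ} (d : Fin n → ℝ) (i : Fin n) : ℝ[X] :=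
  ∏ j ∈ Finset.univ.erase i, (X + C (d j ^ 2))

theorem fCoef_eq_coeff {n : ℕ} (d : Fin n → ℝ) (i : Fin n) (k : ℕ) (hk : k < n) :
    fCoef d (n - 1 - k) i = d i * (otherPoly d i).coeff k := by
  have hcard : (Finset.univ.erase i).card = n - 1 := by
    rw [Finset.card_erase_of_mem (Finset.mem_univ i), Finset.card_univ, Fintype.card_fin]
  unfold fCoef otherPoly
  rw [Finset.prod_X_add_C_coeff _ _ (by omega), hcard]
  simp only [Finset.prod_pow]

/-- `dPoly` with its root `i dᵢ` split off. -/
theorem dPoly_map_eq {n : ℕ} (d : Fin n → ℝ) (i : Fin n) :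
    (dPoly d).map Complex.ofRealHom = (X - C ((d i : ℂ) * Complex.I)) *
      ((X + C ((d i : ℂ) * Complex.I)) *
        (expand ℝ 2 (otherPoly d i)).map Complex.ofRealHom) := by
  have h1 : dPoly d = (X ^ 2 + C (d i ^ 2)) * expand ℝ 2 (otherPoly d i) := by
    unfold dPoly otherPoly
    rw [← Finset.mul_prod_erase _ _ (Finset.mem_univ i), map_prod]
    simp
  rw [h1, Polynomial.map_mul, ← mul_assoc]
  congr 1
  have h2 : (C ((d i : ℂ) * Complex.I) : ℂ[X]) ^ 2 = - C ((d i : ℂ) ^ 2) := by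
    rw [← C_pow, sq_ofReal_mul_I, C_neg, Complex.ofReal_pow]
  simp only [Polynomial.map_add, Polynomial.map_pow, map_X, map_C, Complex.ofRealHom_eq_coe,
    Complex.ofReal_pow]
  linear_combination h2

theorem aeval_dPoly {n : ℕ} (d : Fin n → ℝ) (i : Fin n) :
    aeval ((d i : ℂ) * Complex.I) (dPoly d) = 0 := by
  unfold dPoly
  rw [map_prod]
  refine Finset.prod_eq_zero (Finset.mem_univ i) ?_
  rw [map_add, map_pow, aeval_X, aeval_C, sq_ofReal_mul_I]
  simp

/-- The readout row of the controllable Hamiltonian representation, one oscillator at a time. -/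
theorem re_aeval_divX_iterate_dPoly {n : ℕ} (d : Fin n → ℝ) (i : Fin n) (j : Fin (2 * n)) :
    d i * (aeval ((d i : ℂ) * Complex.I) (divX^[j + 1] (dPoly d))).re =
      if Even (j : ℕ) then 0 else fCoef d ((2 * n - 1 - j) / 2) i := by
  have h : aeval ((d i : ℂ) * Complex.I) (divX^[j + 1] (dPoly d)) =
      eval ((d i : ℂ) * Complex.I) (divX^[j + 1] ((dPoly d).map Complex.ofRealHom)) := by
    rw [← map_divX_iterate, eval_map]
    rfl
  rw [h, dPoly_map_eq d i, eval_divX_iterate_succ_X_sub_C_mul, add_mul, coeff_add, coeff_C_mul,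
    coeff_map]
  rcases Nat.even_or_odd' (j : ℕ) with ⟨k, hk | hk⟩
  · rw [if_pos ⟨k, by omega⟩, hk]
    have h1 : ((X : ℂ[X]) * (expand ℝ 2 (otherPoly d i)).map Complex.ofRealHom).coeff (2 * k) = 0 := by
      cases k with
      | zero => simp
      | succ k =>
        rw [show 2 * (k + 1) = (2 * k + 1) + 1 by ring, coeff_X_mul, coeff_map,
          coeff_expand two_pos, if_neg (by omega), map_zero]
    rw [h1]
    simp
  · rw [if_neg (by rw [Nat.not_even_iff_odd]; exact ⟨k, hk⟩), hk, coeff_X_mul, coeff_map,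
      coeff_expand two_pos, coeff_expand two_pos, if_pos ⟨k, rfl⟩, if_neg (by omega)]
    have h2 : (2 * n - 1 - (2 * k + 1)) / 2 = n - 1 - k := by omega
    rw [h2, fCoef_eq_coeff d i k (by omega)]
    simp

theorem dPoly_monic {n : ℕ} (d : Fin n → ℝ) : (dPoly d).Monic :=
  monic_prod_of_monic _ _ fun _ _ => monic_X_pow_add_C _ two_ne_zero

theorem dPoly_natDegree {n : ℕ} (d : Fin n → ℝ) : (dPoly d).natDegree = 2 * n := by
  unfold dPoly
  rw [natDegree_prod_of_monic _ _ fun _ _ => monic_X_pow_add_C _ two_ne_zero]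
  simp only [natDegree_X_pow_add_C]
  simp [mul_comm]

/-- The controllable Hamiltonian representation has the Markov parameters of the decoupled
oscillators. -/
theorem chSystem_markov {n : ℕ} (x : Par n) (k : ℕ) :
    (chSystem x).markov k = osc x.1 (fun i => (x.1 i * weight x i : ℝ)) (X ^ k) := by
  rcases Nat.eq_zero_or_pos n with rfl | hn
  · simp [LinSys.markov, osc_apply, dotProduct]
  refine companion_markov (dPoly_monic x.1) (dPoly_natDegree x.1) (by omega) _ (fun q => ?_) _
    (fun j => ?_) k
  · rw [osc_apply]
    refine Finset.sum_eq_zero fun i _ => ?_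
    rw [map_mul, aeval_dPoly]
    simp
  · change (if Even (j : ℕ) then 0 else cCoef x _) = _
    rw [osc_apply]
    have : ∀ i, (((x.1 i * weight x i : ℝ) : ℂ) *
        aeval ((x.1 i : ℂ) * Complex.I) (divX^[j + 1] (dPoly x.1))).re =
        (if Even (j : ℕ) then 0 else fCoef x.1 ((2 * n - 1 - j) / 2) i) * weight x i := fun i => by
      rw [← re_aeval_divX_iterate_dPoly, Complex.re_ofReal_mul]
      ring
    rw [Finset.sum_congr rfl fun i _ => this i]
    split_ifs
    · simp
    · rw [cCoef_eq]
      rfl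

theorem chSystem_isControllable {n : ℕ} (x : Par n) : (chSystem x).IsControllable :=
  companion_isControllable _ _

/-- Canonicity of the controllable Hamiltonian representation: if a frequency were repeated or not
excited, fewer than `n` oscillators would realize the same Markov parameters. -/
theorem mem_ThetaCHcan_iff {n : ℕ} {x : Par n} : x ∈ ThetaCHcan n ↔ Generic x := by
  constructor
  · rintro ⟨hd, hcan⟩
    obtain ⟨hcard, -⟩ := exists_sysIso_diagSystem hcan x.1 (fun i => x.1 i * weight x i) hd
      (fun i => mul_nonneg (hd i).le (weight_nonneg x i)) (chSystem_markov x)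
    set S := Finset.univ.filter fun i => x.1 i * weight x i ≠ 0 with hS
    have h1 : (S.image x.1).card = n := by
      rw [Fintype.card_fin] at hcard
      omega
    -- no frequency is lost in the grouping
    have h2 : S = Finset.univ := by
      refine Finset.eq_univ_of_card _ (le_antisymm (Finset.card_le_univ S) ?_)
      rw [Fintype.card_fin]
      exact h1.symm.le.trans Finset.card_image_le
    rw [h2] at h1
    refine ⟨hd, ?_, fun i => ?_⟩
    · have := Finset.card_image_iff.1 (h1.trans (by simp : n = (Finset.univ : Finset (Fin n)).card))
      rwa [Finset.coe_univ, Set.injOn_univ] at this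
    · have : i ∈ S := h2 ▸ Finset.mem_univ i
      exact (weight_nonneg x i).lt_of_ne (right_ne_zero_of_mul (Finset.mem_filter.1 this).2).symm
  · intro hx
    refine ⟨hx.pos, LinSys.isCanonical_of_markov_eq (chSystem_isControllable x)
      hx.diagSystem_isCanonical (fun k => ?_) ?_⟩
    · rw [chSystem_markov, diagSystem_markov]
    · simp [two_mul]

theorem Generic.diagSystem_sysIso_chSystem {n : ℕ} {x : Par n} (hx : Generic x) :
    LinSys.SysIso (diagSystem x) (chSystem x) :=
  LinSys.sysIso_of_markov_eq hx.diagSystem_isCanonical (mem_ThetaCHcan_iff.2 hx).2 fun k => by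
    rw [chSystem_markov, diagSystem_markov]

/-! ### Moments determine the orbit -/

/-- The `k`-th moment `∑ dᵢ wᵢ (dᵢ²)ᵏ` of the atomic measure with mass `dᵢ wᵢ` at `dᵢ²`. Up to sign
it is the Markov parameter of index `2k`. -/
def moment {n : ℕ} (x : Par n) (k : ℕ) : ℝ := ∑ i, x.1 i * weight x i * (x.1 i ^ 2) ^ k

theorem moment_eq_osc {n : ℕ} (x : Par n) (k : ℕ) :
    moment x k = (-1) ^ k * osc x.1 (fun i => (x.1 i * weight x i : ℝ)) (X ^ (2 * k)) := by
  rw [osc_apply, moment, Finset.mul_sum]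
  refine Finset.sum_congr rfl fun i _ => ?_
  rw [map_pow, aeval_X, Complex.re_ofReal_mul, re_pow_two_mul, ← pow_mul]
  have h : ((-1 : ℝ) ^ k) * (-1) ^ k = 1 := by rw [← mul_pow]; simp
  linear_combination -(x.1 i * weight x i * x.1 i ^ (2 * k)) * h

/-- The smooth map given by the first `2n` moments. -/
def momentChart (n : ℕ) (x : Par n) : Fin (2 * n) → ℝ := fun k => moment x k

theorem momentChart_eq_of_sysIso {n : ℕ} {x y : Par n}
    (h : LinSys.SysIso (chSystem x) (chSystem y)) : momentChart n x = momentChart n y := by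
  funext k
  unfold momentChart
  rw [moment_eq_osc, moment_eq_osc, ← chSystem_markov, ← chSystem_markov, h.markov_eq]

theorem sum_eval_eq_sum_coeff_mul_moment {n : ℕ} (x : Par n) {p : ℝ[X]} (hp : p.natDegree < 2 * n) :
    ∑ i, x.1 i * weight x i * p.eval (x.1 i ^ 2) =
      ∑ k : Fin (2 * n), p.coeff k * momentChart n x k := by
  unfold momentChart moment
  simp only [eval_eq_sum_range' hp, Finset.mul_sum, ← Fin.sum_univ_eq_sum_range]
  rw [Finset.sum_comm]
  refine Finset.sum_congr rfl fun k _ => Finset.sum_congr rfl fun i _ => ?_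
  ring

/-- Each frequency of `x` occurs in `y` with the same weight, since a polynomial of degree below
`2n` isolates it among the at most `2n` frequencies of `x` and `y`. -/
theorem Generic.exists_eq_of_momentChart_eq {n : ℕ} {x y : Par n} (hx : Generic x) (hy : Generic y)
    (h : momentChart n x = momentChart n y) (i : Fin n) :
    ∃ j, y.1 j = x.1 i ∧ weight y j = weight x i := by
  classical
  let S : Finset ℝ := (Finset.univ.image fun k => x.1 k ^ 2) ∪ (Finset.univ.image fun k => y.1 k ^ 2)
  let p : ℝ[X] := ∏ a ∈ S.erase (x.1 i ^ 2), (X - C a)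
  have hxS : ∀ k, x.1 k ^ 2 ∈ S := fun k =>
    Finset.mem_union_left _ (Finset.mem_image_of_mem _ (Finset.mem_univ k))
  have hyS : ∀ k, y.1 k ^ 2 ∈ S := fun k =>
    Finset.mem_union_right _ (Finset.mem_image_of_mem _ (Finset.mem_univ k))
  have hp : p.natDegree < 2 * n := by
    have h1 : S.card ≤ n + n := by
      refine (Finset.card_union_le _ _).trans (add_le_add ?_ ?_) <;>
        exact Finset.card_image_le.trans (by simp)
    have h2 : p.natDegree = (S.erase (x.1 i ^ 2)).card := natDegree_finsetProd_X_sub_C_eq_card _ _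
    have h3 := Finset.card_erase_lt_of_mem (hxS i)
    omega
  have hp0 : ∀ a ∈ S, a ≠ x.1 i ^ 2 → p.eval a = 0 := fun a ha hne => by
    rw [eval_prod]
    exact Finset.prod_eq_zero (Finset.mem_erase.2 ⟨hne, ha⟩) (by simp)
  have hpi : p.eval (x.1 i ^ 2) ≠ 0 := by
    rw [eval_prod]
    refine Finset.prod_ne_zero_iff.2 fun a ha => ?_
    rw [eval_sub, eval_X, eval_C]
    exact sub_ne_zero.2 (Finset.ne_of_mem_erase ha).symm
  have hinj : ∀ {z w : Par n}, Generic z → Generic w → ∀ {k l}, z.1 k ^ 2 = w.1 l ^ 2 →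
      z.1 k = w.1 l := fun hz hw k l hkl =>
    (pow_left_inj₀ (hz.pos k).le (hw.pos l).le two_ne_zero).1 hkl
  have heq : ∑ k, x.1 k * weight x k * p.eval (x.1 k ^ 2) =
      ∑ k, y.1 k * weight y k * p.eval (y.1 k ^ 2) := by
    rw [sum_eval_eq_sum_coeff_mul_moment x hp, sum_eval_eq_sum_coeff_mul_moment y hp, h]
  rw [Finset.sum_eq_single i (fun k _ hk => by
    rw [hp0 _ (hxS k) fun hc => hk (hx.injective (hinj hx hx hc)), mul_zero]) (by simp)] at heq
  obtain ⟨j, hj⟩ : ∃ j, y.1 j = x.1 i := by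
    by_contra hne
    push Not at hne
    rw [Finset.sum_eq_zero fun k _ => by
      rw [hp0 _ (hyS k) fun hc => hne k (hinj hy hx hc), mul_zero]] at heq
    exact mul_ne_zero (mul_ne_zero (hx.pos i).ne' (hx.weight_pos i).ne') hpi heq
  refine ⟨j, hj, ?_⟩
  rw [Finset.sum_eq_single j (fun k _ hk => by
    rw [hp0 _ (hyS k) fun hc => hk (hy.injective ((hinj hy hx hc).trans hj.symm)), mul_zero])
    (by simp), hj] at heq
  exact (mul_left_cancel₀ (hx.pos i).ne' (mul_right_cancel₀ hpi heq)).symm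

/-- Two vectors of the plane with the same norm differ by a rotation. -/
theorem exists_circle_rotation {a b a' b' : ℝ} (h : a ^ 2 + b ^ 2 = a' ^ 2 + b' ^ 2)
    (hpos : 0 < a ^ 2 + b ^ 2) : ∃ r : Circle,
      (r : ℂ).re * a - (r : ℂ).im * b = a' ∧ (r : ℂ).im * a + (r : ℂ).re * b = b' := by
  let ξ : ℂ := ⟨a, b⟩
  let η : ℂ := ⟨a', b'⟩
  have hξ : Complex.normSq ξ = a ^ 2 + b ^ 2 := by rw [Complex.normSq_mk]; ring
  have hη : Complex.normSq η = a ^ 2 + b ^ 2 := by rw [Complex.normSq_mk, h]; ring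
  have hξ0 : ξ ≠ 0 := fun h0 => hpos.ne' (by rw [← hξ, h0, map_zero])
  have hnorm : ‖η / ξ‖ = 1 := by
    have : Complex.normSq (η / ξ) = 1 := by
      rw [Complex.normSq_div, hξ, hη, div_self hpos.ne']
    rw [Complex.normSq_eq_norm_sq] at this
    exact (pow_eq_one_iff_of_nonneg (norm_nonneg _) two_ne_zero).1 this
  refine ⟨⟨η / ξ, mem_sphere_zero_iff_norm.2 hnorm⟩, ?_, ?_⟩
  · have := congrArg Complex.re (div_mul_cancel₀ η hξ0)
    rwa [Complex.mul_re] at this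
  · have := congrArg Complex.im (div_mul_cancel₀ η hξ0)
    rw [Complex.mul_im] at this
    rw [add_comm]
    exact this

theorem Generic.exists_act_eq {n : ℕ} {x y : Par n} (hx : Generic x) (hy : Generic y)
    (h : momentChart n x = momentChart n y) : ∃ g, act g x = y := by
  choose τ hτ hw using hx.exists_eq_of_momentChart_eq hy h
  have hinj : Function.Injective τ := fun i j hij =>
    hx.injective (by rw [← hτ i, ← hτ j, hij])
  let σ : Equiv.Perm (Fin n) := Equiv.ofBijective τ (Finite.injective_iff_bijective.1 hinj)
  have hd : ∀ j, x.1 (σ⁻¹ j) = y.1 j := fun j => by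
    rw [← hτ]
    exact congrArg y.1 (σ.apply_symm_apply j)
  have hwt : ∀ j, weight x (σ⁻¹ j) = weight y j := fun j => by
    rw [← hw]
    exact congrArg (weight y) (σ.apply_symm_apply j)
  choose r hr hr' using fun j => exists_circle_rotation (hwt j) (hx.weight_pos (σ⁻¹ j))
  refine ⟨⟨r, σ⟩, ?_⟩
  ext j
  · exact hd j
  · rcases j with j | j
    · exact hr j
    · exact hr' j

theorem momentChart_eq_iff {n : ℕ} (x y : ThetaCHcan n) :
    momentChart n x.1 = momentChart n y.1 ↔
      (Quotient.mk _ x : MulAction.orbitRel.Quotient (PermTorus n) (ThetaCHcan n)) =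
        Quotient.mk _ y := by
  rw [Quotient.eq, MulAction.orbitRel_apply, MulAction.mem_orbit_iff]
  constructor
  · intro h
    obtain ⟨g, hg⟩ := Generic.exists_act_eq (mem_ThetaCHcan_iff.1 y.2) (mem_ThetaCHcan_iff.1 x.2)
      h.symm
    exact ⟨g, Subtype.ext hg⟩
  · rintro ⟨g, rfl⟩
    change momentChart n (act g y.1) = _
    refine momentChart_eq_of_sysIso ?_
    rw [chSystem_act]
    exact LinSys.SysIso.refl _

theorem sysIso_chSystem_iff {n : ℕ} (x y : ThetaCHcan n) :
    LinSys.SysIso (chSystem x.1) (chSystem y.1) ↔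
      (Quotient.mk _ x : MulAction.orbitRel.Quotient (PermTorus n) (ThetaCHcan n)) =
        Quotient.mk _ y := by
  constructor
  · intro h
    exact (momentChart_eq_iff x y).1 (momentChart_eq_of_sysIso h)
  · intro h
    rw [Quotient.eq, MulAction.orbitRel_apply, MulAction.mem_orbit_iff] at h
    obtain ⟨g, rfl⟩ := h
    change LinSys.SysIso (chSystem (act g y.1)) _
    rw [chSystem_act]
    exact LinSys.SysIso.refl _

/-! ### The moment chart is a submersion -/

theorem contDiff_momentChart (n : ℕ) : ContDiff ℝ (⊤ : ℕ∞) (momentChart n) := by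
  refine contDiff_pi.2 fun k => ?_
  unfold momentChart moment weight
  fun_prop

/-- A polynomial of degree below `2n` with `n` double roots is zero. -/
theorem eq_zero_of_double_roots {n : ℕ} {p : ℝ[X]} (hp : p.natDegree < 2 * n) {a : Fin n → ℝ}
    (ha : Function.Injective a) (h : ∀ i, p.eval (a i) = 0)
    (h' : ∀ i, (derivative p).eval (a i) = 0) : p = 0 := by
  classical
  by_contra hp0
  have hmult : ∀ i, 2 ≤ p.roots.count (a i) := fun i => by
    rw [count_roots]
    exact (one_lt_rootMultiplicity_iff_isRoot hp0).2 ⟨h i, h' i⟩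
  have hsub : Finset.univ.image a ⊆ p.roots.toFinset := fun r hr => by
    obtain ⟨i, -, rfl⟩ := Finset.mem_image.1 hr
    rw [Multiset.mem_toFinset, mem_roots hp0]
    exact h i
  have h1 : (Finset.univ.image a).card • 2 ≤ ∑ r ∈ Finset.univ.image a, p.roots.count r :=
    Finset.card_nsmul_le_sum _ _ _ fun r hr => by
      obtain ⟨i, -, rfl⟩ := Finset.mem_image.1 hr
      exact hmult i
  rw [Finset.card_image_of_injective _ ha, Finset.card_univ, Fintype.card_fin, smul_eq_mul] at h1
  have h2 := Finset.sum_le_sum_of_subset (f := fun r => p.roots.count r) hsub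
  rw [Multiset.toFinset_sum_count_eq] at h2
  have h3 := card_roots' p
  omega

/-- The directional derivatives of `x ↦ ∑ dᵢ wᵢ p(dᵢ²)`. -/
theorem hasDerivAt_sum_eval {n : ℕ} (x e : Par n) (p : ℝ[X]) :
    HasDerivAt (fun t : ℝ => ∑ i, (x + t • e).1 i * weight (x + t • e) i *
        p.eval ((x + t • e).1 i ^ 2))
      (∑ i, ((e.1 i * weight x i + x.1 i * (2 * (x.2 (Sum.inl i) * e.2 (Sum.inl i) +
          x.2 (Sum.inr i) * e.2 (Sum.inr i)))) * p.eval (x.1 i ^ 2) +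
        x.1 i * weight x i * ((derivative p).eval (x.1 i ^ 2) * (2 * x.1 i * e.1 i)))) 0 := by
  refine HasDerivAt.fun_sum fun i _ => ?_
  have line : ∀ a b : ℝ, HasDerivAt (fun t : ℝ => a + t * b) b 0 := fun a b => by
    simpa using ((hasDerivAt_id (0 : ℝ)).mul_const b).const_add a
  have hd := line (x.1 i) (e.1 i)
  have hw := ((line (x.2 (Sum.inl i)) (e.2 (Sum.inl i))).pow 2).add
    ((line (x.2 (Sum.inr i)) (e.2 (Sum.inr i))).pow 2)
  have hp := (p.hasDerivAt _).comp (0 : ℝ) (hd.pow 2)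
  refine ((hd.mul hw).mul hp).congr_deriv ?_
  simp only [weight, Pi.add_apply, Pi.mul_apply, Pi.pow_apply, Function.comp_apply, zero_mul,
    add_zero, Nat.cast_ofNat, Nat.add_one_sub_one, pow_one]
  ring

/-- A functional killing the range of the derivative corresponds to a polynomial of degree below
`2n` which has double roots at all `dᵢ²`. -/
theorem Generic.surjective_fderiv_momentChart {n : ℕ} {x : Par n} (hx : Generic x) :
    Function.Surjective (fderiv ℝ (momentChart n) x) := by
  rcases Nat.eq_zero_or_pos n with rfl | hn
  · exact fun y => ⟨0, funext fun k => absurd k.2 (by simp)⟩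
  by_contra hns
  obtain ⟨f, hf, hker⟩ := Submodule.exists_le_ker_of_lt_top
    (LinearMap.range (fderiv ℝ (momentChart n) x).toLinearMap)
    (lt_top_iff_ne_top.2 fun h => hns (LinearMap.range_eq_top.1 h))
  let α : Fin (2 * n) → ℝ := fun k => f (Pi.single k 1)
  have hα := dual_eq_dotProduct f
  let p : ℝ[X] := ∑ k : Fin (2 * n), C (α k) * X ^ (k : ℕ)
  have hdeg : p.natDegree < 2 * n := by
    have h1 : p.degree < ((2 * n : ℕ) : WithBot ℕ) := degree_sum_fin_lt α
    by_cases h0 : p = 0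
    · rw [h0, natDegree_zero]; omega
    · exact (natDegree_lt_iff_degree_lt h0).2 h1
  have hcoeff : ∀ k : Fin (2 * n), p.coeff k = α k := fun k => by
    simp [p, finsetSum_coeff, coeff_X_pow, ← Fin.ext_iff]
  have hφ : ∀ y : Par n, f (momentChart n y) = ∑ i, y.1 i * weight y i * p.eval (y.1 i ^ 2) :=
    fun y => by
      rw [sum_eval_eq_sum_coeff_mul_moment y hdeg, hα]
      exact Finset.sum_congr rfl fun k _ => by rw [hcoeff]
  have hzero : ∀ e : Par n, ∑ i, ((e.1 i * weight x i + x.1 i * (2 * (x.2 (Sum.inl i) *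
      e.2 (Sum.inl i) + x.2 (Sum.inr i) * e.2 (Sum.inr i)))) * p.eval (x.1 i ^ 2) +
        x.1 i * weight x i * ((derivative p).eval (x.1 i ^ 2) * (2 * x.1 i * e.1 i))) = 0 := by
    intro e
    refine (hasDerivAt_sum_eval x e p).unique ?_
    simp only [← hφ]
    have hline : HasDerivAt (fun t : ℝ => x + t • e) e 0 := by
      simpa using ((hasDerivAt_id (0 : ℝ)).smul_const e).const_add x
    have hχ : HasFDerivAt (momentChart n) (fderiv ℝ (momentChart n) x) (x + (0 : ℝ) • e) := by
      rw [zero_smul, add_zero]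
      exact ((contDiff_momentChart n).differentiable (by simp) x).hasFDerivAt
    have h1 := f.toContinuousLinearMap.hasFDerivAt.comp_hasDerivAt (0 : ℝ)
      (hχ.comp_hasDerivAt (0 : ℝ) hline)
    have h2 : f (fderiv ℝ (momentChart n) x e) = 0 := hker ⟨e, rfl⟩
    exact h1.congr_deriv h2
  have hroot : ∀ i, p.eval (x.1 i ^ 2) = 0 := fun i => by
    -- scale the amplitude of the `i`-th oscillator
    have h := hzero (0, Sum.elim (fun j => if j = i then x.2 (Sum.inl j) else 0)
      (fun j => if j = i then x.2 (Sum.inr j) else 0))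
    rw [Finset.sum_eq_single i (fun j _ hj => by simp [hj]) (by simp)] at h
    simp only [Pi.zero_apply, Sum.elim_inl, Sum.elim_inr, if_true, zero_mul, mul_zero,
      add_zero, zero_add, ← pow_two] at h
    refine (mul_eq_zero.1 h).resolve_left ?_
    exact mul_ne_zero (hx.pos i).ne' (mul_ne_zero two_ne_zero (hx.weight_pos i).ne')
  have hroot' : ∀ i, (derivative p).eval (x.1 i ^ 2) = 0 := fun i => by
    -- vary the `i`-th frequency
    have h := hzero (Pi.single i 1, 0)
    rw [Finset.sum_eq_single i (fun j _ hj => by simp [hj]) (by simp)] at h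
    simp only [hroot, mul_zero, zero_add, Pi.single_eq_same, mul_one] at h
    have h1 := (hx.pos i).ne'
    have h2 := (hx.weight_pos i).ne'
    simpa [h1, h2] using h
  have hp0 : p = 0 := eq_zero_of_double_roots hdeg (a := fun i => x.1 i ^ 2)
    (fun i j hij => hx.injective
      ((pow_left_inj₀ (hx.pos i).le (hx.pos j).le two_ne_zero).1 hij)) hroot hroot'
  refine hf (LinearMap.ext fun v => ?_)
  rw [hα, LinearMap.zero_apply]
  refine Finset.sum_eq_zero fun k _ => ?_
  have := hcoeff k
  rw [hp0, coeff_zero] at this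
  change α k * v k = 0
  rw [← this, zero_mul]

/-! ### Open and dense sets of canonical parameters -/

open Filter Topology in
theorem eventually_add_mul_ne_zero (a : ℝ) {b : ℝ} (hb : b ≠ 0) :
    ∀ᶠ t in 𝓝[>] (0 : ℝ), a + t * b ≠ 0 := by
  rcases eq_or_ne a 0 with rfl | ha
  · filter_upwards [self_mem_nhdsWithin] with t ht
    rw [zero_add]
    exact mul_ne_zero (Set.mem_Ioi.1 ht).ne' hb
  · have h : Tendsto (fun t : ℝ => a + t * b) (𝓝 0) (𝓝 a) := by
      have : Continuous fun t : ℝ => a + t * b := by fun_prop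
      simpa using this.tendsto 0
    exact (h.mono_left nhdsWithin_le_nhds).eventually_ne ha

theorem isOpen_ThetaCHcan (n : ℕ) : IsOpen (ThetaCHcan n) := by
  have h : ThetaCHcan n = (⋂ i, {x : Par n | 0 < x.1 i}) ∩
      ((⋂ i, ⋂ j, {x : Par n | i ≠ j → x.1 i ≠ x.1 j}) ∩ ⋂ i, {x : Par n | 0 < weight x i}) := by
    ext x
    rw [mem_ThetaCHcan_iff]
    simp only [Set.mem_inter_iff, Set.mem_iInter, Set.mem_ofPred_eq]
    exact ⟨fun h => ⟨h.pos, fun i j hij hc => hij (h.injective hc), h.weight_pos⟩,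
      fun h => ⟨h.1, fun i j hc => by_contra fun hij => h.2.1 i j hij hc, h.2.2⟩⟩
  rw [h]
  refine (isOpen_iInter_of_finite fun i => isOpen_lt continuous_const (by fun_prop)).inter
    ((isOpen_iInter_of_finite fun i => isOpen_iInter_of_finite fun j => ?_).inter
      (isOpen_iInter_of_finite fun i => isOpen_lt continuous_const (by unfold weight; fun_prop)))
  by_cases hij : i = j
  · simp [hij]
  · simp only [ne_eq, hij, not_false_eq_true, true_imp_iff]
    exact isOpen_ne_fun (by fun_prop) (by fun_prop)

open Filter Topology in
theorem ThetaCH_subset_closure (n : ℕ) : ThetaCH n ⊆ closure (ThetaCHcan n) := by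
  intro x hx
  -- a direction along which frequencies separate and no amplitude stays zero
  let e : Par n := (fun i => (i : ℝ), fun _ => 1)
  have hlim : Tendsto (fun t : ℝ => x + t • e) (𝓝[>] 0) (𝓝 x) := by
    have : Continuous fun t : ℝ => x + t • e := by fun_prop
    have h := this.tendsto 0
    rw [zero_smul, add_zero] at h
    exact h.mono_left nhdsWithin_le_nhds
  refine mem_closure_of_tendsto hlim ?_
  have h1 : ∀ᶠ t in 𝓝[>] (0 : ℝ), ∀ i j, i ≠ j → (x.1 i - x.1 j) + t * ((i : ℝ) - j) ≠ 0 := by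
    refine eventually_all.2 fun i => eventually_all.2 fun j => ?_
    by_cases hij : i = j
    · simp [hij]
    · filter_upwards [eventually_add_mul_ne_zero (x.1 i - x.1 j) (b := (i : ℝ) - j)
        (sub_ne_zero.2 fun hc => hij (Fin.ext (by exact_mod_cast hc)))] with t ht _
      exact ht
  have h2 : ∀ᶠ t in 𝓝[>] (0 : ℝ), ∀ i, x.2 (Sum.inl i) + t * 1 ≠ 0 :=
    eventually_all.2 fun i => eventually_add_mul_ne_zero _ one_ne_zero
  filter_upwards [h1, h2, self_mem_nhdsWithin] with t ht1 ht2 ht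
  have ht' : 0 < t := ht
  refine mem_ThetaCHcan_iff.2 ⟨fun i => ?_, fun i j hc => by_contra fun hij => ht1 i j hij ?_,
    fun i => ?_⟩
  · exact add_pos_of_pos_of_nonneg (hx i) (mul_nonneg ht'.le (Nat.cast_nonneg _))
  · have hc' : x.1 i + t * i = x.1 j + t * j := hc
    linear_combination hc'
  · exact add_pos_of_pos_of_nonneg (sq_pos_of_ne_zero (by simpa [e] using ht2 i)) (sq_nonneg _)

/-- Canonicity is the nonvanishing of two Gram determinants. -/
theorem isCanonical_iff_det_ne_zero {ι : Type} [Fintype ι] [DecidableEq ι] (s : LinSys ι) :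
    s.IsCanonical ↔
      (s.controllabilityMatrix * s.controllabilityMatrix.transpose).det *
        (s.observabilityMatrix.transpose * s.observabilityMatrix).det ≠ 0 := by
  unfold LinSys.IsCanonical LinSys.IsControllable LinSys.IsObservable
  rw [mul_ne_zero_iff, rank_eq_card_iff_det_gram_ne_zero, ← Matrix.rank_transpose
    s.observabilityMatrix, rank_eq_card_iff_det_gram_ne_zero, Matrix.transpose_transpose]

theorem isOpen_canonical_ThetaPH (n : ℕ) :
    IsOpen {p : ThetaPH n | (phSystem p.1).IsCanonical} := by
  simp only [isCanonical_iff_det_ne_zero]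
  have hA : Continuous fun p : ThetaPH n => (phSystem p.1).A :=
    continuous_const.matrix_mul (continuous_fst.comp continuous_subtype_val)
  have hB : Continuous fun p : ThetaPH n => (phSystem p.1).B :=
    continuous_snd.comp continuous_subtype_val
  have hC : Continuous fun p : ThetaPH n => (phSystem p.1).C :=
    hB.matrix_vecMul (continuous_fst.comp continuous_subtype_val)
  have hctr : Continuous fun p : ThetaPH n => (phSystem p.1).controllabilityMatrix :=
    continuous_matrix fun i k => (continuous_apply i).comp ((hA.pow k).matrix_mulVec hB)
  have hobs : Continuous fun p : ThetaPH n => (phSystem p.1).observabilityMatrix :=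
    continuous_matrix fun k j => (continuous_apply j).comp (hC.matrix_vecMul (hA.pow k))
  exact isOpen_ne_fun ((hctr.matrix_mul hctr.matrix_transpose).matrix_det.mul
    (hobs.matrix_transpose.matrix_mul hobs).matrix_det) continuous_const

/-- Along a family of systems depending polynomially on `t`, canonicity is the nonvanishing of a
polynomial in `t`. -/
theorem exists_polynomial_isCanonical_iff {ι : Type} [Fintype ι] [DecidableEq ι]
    (A : Matrix ι ι ℝ[X]) (B C : ι → ℝ[X]) :
    ∃ F : ℝ[X], ∀ t : ℝ, (LinSys.mk (A.map (eval t)) (fun i => (B i).eval t)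
      (fun i => (C i).eval t)).IsCanonical ↔ F.eval t ≠ 0 := by
  let G : Matrix ι (Fin (Fintype.card ι)) ℝ[X] :=
    Matrix.of fun i k => Matrix.mulVec (A ^ (k : ℕ)) B i
  let H : Matrix (Fin (Fintype.card ι)) ι ℝ[X] :=
    Matrix.of fun k j => Matrix.vecMul C (A ^ (k : ℕ)) j
  refine ⟨(G * G.transpose).det * (H.transpose * H).det, fun t => ?_⟩
  rw [isCanonical_iff_det_ne_zero]
  have hpow : ∀ k : ℕ, (A.map (eval t)) ^ k = (A ^ k).map (evalRingHom t) := fun k =>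
    (map_pow (evalRingHom t).mapMatrix A k).symm
  have hG : (LinSys.mk (A.map (eval t)) (fun i => (B i).eval t)
      (fun i => (C i).eval t)).controllabilityMatrix = G.map (evalRingHom t) := by
    ext i k
    change Matrix.mulVec ((A.map (eval t)) ^ (k : ℕ)) (fun i => (B i).eval t) i =
      evalRingHom t (Matrix.mulVec (A ^ (k : ℕ)) B i)
    rw [hpow, RingHom.map_mulVec]
    rfl
  have hH : (LinSys.mk (A.map (eval t)) (fun i => (B i).eval t)
      (fun i => (C i).eval t)).observabilityMatrix = H.map (evalRingHom t) := by
    ext k j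
    change Matrix.vecMul (fun i => (C i).eval t) ((A.map (eval t)) ^ (k : ℕ)) j =
      evalRingHom t (Matrix.vecMul C (A ^ (k : ℕ)) j)
    rw [hpow, RingHom.map_vecMul]
    rfl
  rw [hG, hH, ← Matrix.transpose_map, ← Matrix.transpose_map, ← Matrix.map_mul, ← Matrix.map_mul,
    ← RingHom.mapMatrix_apply, ← RingHom.mapMatrix_apply, ← RingHom.map_det, ← RingHom.map_det,
    ← map_mul, coe_evalRingHom]

/-- The oscillators with frequencies `1, …, n` and unit amplitudes. -/
theorem exists_generic (n : ℕ) : ∃ x : Par n, Generic x :=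
  ⟨(fun i => (i : ℝ) + 1, Sum.elim 1 0), fun i => by positivity,
    fun i j h => Fin.ext (by exact_mod_cast add_right_cancel h), fun i => by simp [weight]⟩

open Filter Topology in
theorem eventually_eval_ne_zero {F : ℝ[X]} (hF : F ≠ 0) (a : ℝ) :
    ∀ᶠ t in 𝓝[>] a, F.eval t ≠ 0 := by
  have hfin : ({t : ℝ | F.IsRoot t} \ {a}).Finite := (finite_setOfPred_isRoot hF).subset Set.sdiff_subset
  have h : ({t : ℝ | F.IsRoot t} \ {a})ᶜ ∈ 𝓝 a := hfin.isClosed.isOpen_compl.mem_nhds (by simp)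
  filter_upwards [mem_nhdsWithin_of_mem_nhds h, self_mem_nhdsWithin] with t ht hta hroot
  exact ht ⟨hroot, (Set.mem_Ioi.1 hta).ne'⟩

open Filter Topology in
/-- On the segment to a canonical point, canonicity fails at finitely many points only. -/
theorem dense_canonical_ThetaPH (n : ℕ) :
    Dense {p : ThetaPH n | (phSystem p.1).IsCanonical} := by
  rw [Subtype.dense_iff]
  rintro ⟨Q, B⟩ hQ
  obtain ⟨x, hx⟩ := exists_generic n
  let Q₁ := Matrix.fromBlocks (Matrix.diagonal x.1) 0 0 (Matrix.diagonal x.1)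
  let path : ℝ → Matrix (Fin n ⊕ Fin n) (Fin n ⊕ Fin n) ℝ × (Fin n ⊕ Fin n → ℝ) :=
    fun t => ((1 - t) • Q + t • Q₁, (1 - t) • B + t • x.2)
  let P : Matrix (Fin n ⊕ Fin n) (Fin n ⊕ Fin n) ℝ[X] :=
    Matrix.of fun i j => (1 - X) * C (Q i j) + X * C (Q₁ i j)
  let b : Fin n ⊕ Fin n → ℝ[X] := fun i => (1 - X) * C (B i) + X * C (x.2 i)
  obtain ⟨F, hF⟩ := exists_polynomial_isCanonical_iff ((JJ n).map C * P) b (Matrix.vecMul b P)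
  have hsys : ∀ t, LinSys.mk (((JJ n).map C * P).map (eval t)) (fun i => (b i).eval t)
      (fun i => (Matrix.vecMul b P i).eval t) = phSystem (path t) := fun t => by
    have hP : P.map (eval t) = (path t).1 := by ext i j; simp [P, path]; exact mul_comm _ _
    have hb : (fun i => (b i).eval t) = (path t).2 := by funext i; simp [b, path]; exact mul_comm _ _
    refine LinSys.ext ?_ hb ?_
    · change ((JJ n).map C * P).map (evalRingHom t) = JJ n * (path t).1
      rw [Matrix.map_mul, ← hP]
      congr 1
      ext i j
      simp
    · change (fun i => evalRingHom t (Matrix.vecMul b P i)) = Matrix.vecMul (path t).2 (path t).1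
      rw [← hP, ← hb]
      funext i
      rw [RingHom.map_vecMul]
      rfl
  simp only [hsys] at hF
  have hF0 : F ≠ 0 := by
    have h1 : path 1 = (Q₁, x.2) := by simp [path]
    rintro rfl
    refine (hF 1).1 ?_ eval_zero
    rw [h1]
    exact hx.diagSystem_isCanonical
  have hlim : Tendsto path (𝓝[>] 0) (𝓝 (Q, B)) := by
    have hc : Continuous path := by fun_prop
    have h := hc.tendsto 0
    have h0 : path 0 = (Q, B) := by simp [path]
    rw [h0] at h
    exact h.mono_left nhdsWithin_le_nhds
  refine mem_closure_of_tendsto hlim ?_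
  filter_upwards [eventually_eval_ne_zero hF0 0, self_mem_nhdsWithin,
    mem_nhdsWithin_of_mem_nhds (Iio_mem_nhds one_pos)] with t ht ht0 ht1
  refine ⟨⟨path t, ?_⟩, (hF t).2 ht, rfl⟩
  have hQ' : Q.PosDef := hQ
  exact (hQ'.smul (sub_pos.2 ht1)).add ((fromBlocks_diagonal_posDef hx.pos).smul ht0)

/-! ### The two bijections -/

theorem diagSystem_eq_phiS {n : ℕ} (x : Par n) : diagSystem x = phiS 1 x := by
  simp [diagSystem, phiS]

theorem phiS_mem_PHcan {n : ℕ} {S : Matrix (Fin n ⊕ Fin n) (Fin n ⊕ Fin n) ℝ}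
    (hS : S ∈ Matrix.symplecticGroup (Fin n) ℝ) {x : Par n} (hx : Generic x) :
    phiS S x ∈ PHcan n :=
  ⟨phiS_mem_PH hS hx.pos, (phiS_sysIso_diagSystem hS x).symm.isCanonical hx.diagSystem_isCanonical⟩

theorem diagSystem_mem_PHcan {n : ℕ} {x : Par n} (hx : Generic x) : diagSystem x ∈ PHcan n :=
  diagSystem_eq_phiS x ▸ phiS_mem_PHcan (one_mem _) hx

/-- Input/output systems correspond to isomorphism classes. -/
theorem exists_equiv_FilterPHcan (n : ℕ) {I : Set ℝ} (hI : I.OrdConnected) (hI' : I.Nontrivial)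
    (h0 : (0 : ℝ) ∈ I) :
    ∃ e : FilterPHcan n I ≃ Quotient (sysSetoid n), ∀ s : PHcan n,
      e ⟨s.1.ioSystem I, Set.mem_image_of_mem _ s.2⟩ = Quotient.mk (sysSetoid n) s := by
  have hiff : ∀ s t : PHcan n, LinSys.SysIso s.1 t.1 ↔ s.1.ioSystem I = t.1.ioSystem I :=
    fun s t => (LinSys.sysIso_tfae hI hI' h0 s.2.2 t.2.2).out 0 3
  let G : Quotient (sysSetoid n) → FilterPHcan n I :=
    Quotient.lift (fun s : PHcan n => (⟨s.1.ioSystem I, Set.mem_image_of_mem _ s.2⟩ :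
      FilterPHcan n I)) fun s t hst => Subtype.ext ((hiff s t).1 hst)
  have hG : Function.Bijective G := by
    constructor
    · intro q r
      induction q using Quotient.inductionOn
      induction r using Quotient.inductionOn
      exact fun h => Quotient.sound ((hiff _ _).2 (congrArg Subtype.val h))
    · rintro ⟨-, s, hs, rfl⟩
      exact ⟨Quotient.mk _ ⟨s, hs⟩, rfl⟩
  refine ⟨(Equiv.ofBijective G hG).symm, fun s => ?_⟩
  rw [Equiv.symm_apply_eq]
  rfl

/-- Isomorphism classes correspond to orbits, through the decoupled oscillators. -/
theorem exists_equiv_orbits (n : ℕ) :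
    ∃ e : Quotient (sysSetoid n) ≃ MulAction.orbitRel.Quotient (PermTorus n) (ThetaCHcan n),
      ∀ (s : PHcan n) (x : ThetaCHcan n),
        e (Quotient.mk (sysSetoid n) s) = Quotient.mk _ x ↔
          LinSys.SysIso s.1 (chSystem x.1) := by
  have hgen : ∀ x : ThetaCHcan n, Generic x.1 := fun x => mem_ThetaCHcan_iff.1 x.2
  have hiff : ∀ x y : ThetaCHcan n, LinSys.SysIso (diagSystem x.1) (diagSystem y.1) ↔
      (Quotient.mk _ x : MulAction.orbitRel.Quotient (PermTorus n) (ThetaCHcan n)) =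
        Quotient.mk _ y := fun x y => by
    have hx := (hgen x).diagSystem_sysIso_chSystem
    have hy := (hgen y).diagSystem_sysIso_chSystem
    rw [← sysIso_chSystem_iff]
    exact ⟨fun h => (hx.symm.trans h).trans hy, fun h => (hx.trans h).trans hy.symm⟩
  let G : MulAction.orbitRel.Quotient (PermTorus n) (ThetaCHcan n) → Quotient (sysSetoid n) :=
    Quotient.lift (fun x : ThetaCHcan n =>
      Quotient.mk (sysSetoid n) ⟨diagSystem x.1, diagSystem_mem_PHcan (hgen x)⟩)
      fun x y hxy => Quotient.sound ((hiff x y).2 (Quotient.sound hxy))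
  have hG : Function.Bijective G := by
    constructor
    · intro q r
      induction q using Quotient.inductionOn
      induction r using Quotient.inductionOn
      exact fun h => (hiff _ _).1 (Quotient.exact h)
    · intro q
      induction q using Quotient.inductionOn with
      | h s =>
        obtain ⟨x, hx, hsx⟩ := exists_generic_sysIso_of_mem_PHcan s.2
        exact ⟨Quotient.mk _ ⟨x, mem_ThetaCHcan_iff.2 hx⟩, Quotient.sound hsx.symm⟩
  refine ⟨(Equiv.ofBijective G hG).symm, fun s x => ?_⟩
  have hx := (hgen x).diagSystem_sysIso_chSystem
  rw [Equiv.symm_apply_eq]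
  exact ⟨fun h => LinSys.SysIso.trans (Quotient.exact h) hx,
    fun h => Quotient.sound (h.trans hx.symm)⟩

open Filter Topology in
theorem isOpen_image_momentChart (n : ℕ) : IsOpen (momentChart n '' ThetaCHcan n) := by
  rw [isOpen_iff_mem_nhds]
  rintro _ ⟨x, hx, rfl⟩
  have hd : HasStrictFDerivAt (momentChart n) (fderiv ℝ (momentChart n) x) x :=
    (contDiff_momentChart n).contDiffAt.hasStrictFDerivAt (by simp)
  rw [← hd.map_nhds_eq_of_surj (LinearMap.range_eq_top.2
    (mem_ThetaCHcan_iff.1 hx).surjective_fderiv_momentChart)]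
  exact image_mem_map ((isOpen_ThetaCHcan n).mem_nhds hx)

end PortHam

end

theorem mainTheorem3 (n : ℕ) (I : Set ℝ) (hI : I.OrdConnected) (hI' : I.Nontrivial)
    (h0 : (0 : ℝ) ∈ I) :
    -- every port-Hamiltonian system has a filter
    (∀ s ∈ PortHam.PH n, ∀ (u : PortHam.C1 I ℝ) (z₀ : Fin n ⊕ Fin n → ℝ),
      ∃! z : PortHam.C1 I (Fin n ⊕ Fin n → ℝ), s.IsSolution I u z₀ z) ∧
    -- canonical systems form an open dense set of port-Hamiltonian systems
    IsOpen {p : PortHam.ThetaPH n | (PortHam.phSystem p.1).IsCanonical} ∧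
    Dense {p : PortHam.ThetaPH n | (PortHam.phSystem p.1).IsCanonical} ∧
    -- two canonical systems are isomorphic if and only if they have the same filter, in each of
    -- the usual senses
    (∀ s ∈ PortHam.PHcan n, ∀ t ∈ PortHam.PHcan n, List.TFAE [
      PortHam.LinSys.SysIso s t,
      ∃ f : (Fin n ⊕ Fin n → ℝ) ≃ (Fin n ⊕ Fin n → ℝ), s.IsSystemMorphism t f,
      ∃ f : (Fin n ⊕ Fin n → ℝ) ≃ (Fin n ⊕ Fin n → ℝ), ∀ u z₀, t.filter I u (f z₀) = s.filter I u z₀,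
      s.ioSystem I = t.ioSystem I,
      ∀ u, s.filter I u 0 = t.filter I u 0]) ∧
    -- first bijection: filters and isomorphism classes
    (∃ e : PortHam.FilterPHcan n I ≃ Quotient (PortHam.sysSetoid n),
      ∀ s : PortHam.PHcan n,
        e ⟨s.1.ioSystem I, Set.mem_image_of_mem _ s.2⟩ = Quotient.mk (PortHam.sysSetoid n) s) ∧
    -- the set of canonical parameters is an open dense subset of the parameter space
    IsOpen (PortHam.ThetaCHcan n) ∧
    PortHam.ThetaCH n ⊆ closure (PortHam.ThetaCHcan n) ∧
    -- second bijection: isomorphism classes and orbits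
    (∃ e : Quotient (PortHam.sysSetoid n) ≃
        MulAction.orbitRel.Quotient (PortHam.PermTorus n) (PortHam.ThetaCHcan n),
      (∀ (s : PortHam.PHcan n) (x : PortHam.ThetaCHcan n),
        e (Quotient.mk (PortHam.sysSetoid n) s) = Quotient.mk _ x ↔
          PortHam.LinSys.SysIso s.1 (PortHam.chSystem x.1)) ∧
      ∀ S ∈ Matrix.symplecticGroup (Fin n) ℝ, ∀ x : PortHam.ThetaCHcan n,
        ∃ h : PortHam.phiS S x.1 ∈ PortHam.PHcan n,
          e (Quotient.mk (PortHam.sysSetoid n) ⟨PortHam.phiS S x.1, h⟩) = Quotient.mk _ x) ∧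
    -- a smooth global chart of the orbit space, with `2n` parameters
    (∃ χ : PortHam.Par n → (Fin (2 * n) → ℝ),
      ContDiffOn ℝ (⊤ : ℕ∞) χ (PortHam.ThetaCHcan n) ∧
      (∀ x ∈ PortHam.ThetaCHcan n, Function.Surjective (fderiv ℝ χ x)) ∧
      IsOpen (χ '' PortHam.ThetaCHcan n) ∧
      ∀ x y : PortHam.ThetaCHcan n, χ x.1 = χ y.1 ↔
        (Quotient.mk _ x : MulAction.orbitRel.Quotient (PortHam.PermTorus n)
          (PortHam.ThetaCHcan n)) = Quotient.mk _ y) := by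
  refine ⟨?_, PortHam.isOpen_canonical_ThetaPH n, PortHam.dense_canonical_ThetaPH n, ?_,
    PortHam.exists_equiv_FilterPHcan n hI hI' h0, PortHam.isOpen_ThetaCHcan n,
    PortHam.ThetaCH_subset_closure n, ?_, PortHam.momentChart n,
    (PortHam.contDiff_momentChart n).contDiffOn, ?_, PortHam.isOpen_image_momentChart n,
    PortHam.momentChart_eq_iff⟩
  · exact fun s _ u z₀ => PortHam.LinSys.existsUnique_isSolution hI hI' h0 s u z₀
  · exact fun s hs t ht => PortHam.LinSys.sysIso_tfae hI hI' h0 hs.2 ht.2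
  · obtain ⟨e, he⟩ := PortHam.exists_equiv_orbits n
    refine ⟨e, he, fun S hS x => ?_⟩
    have hx := PortHam.mem_ThetaCHcan_iff.1 x.2
    exact ⟨PortHam.phiS_mem_PHcan hS hx, (he _ x).2
      ((PortHam.phiS_sysIso_diagSystem hS x.1).trans hx.diagSystem_sysIso_chSystem)⟩
  · exact fun x hx => (PortHam.mem_ThetaCHcan_iff.1 hx).surjective_fderiv_momentChart
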